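/- Consider the problem of minimizing $f_0(x)$ over $x\in\mathbb R^n$ subject to $f_j(x)\le 0$, $j\in I=\{1,\dots,m\}$, with $f_0,f_1,\dots,f_m:\mathbb R^n\to\mathbb R$. Write $g_j=\nabla f_j$, $\varphi(x)=\max\{0,f_1(x),\dots,f_m(x)\}$, $\bar f_j(x)=f_j(x)$ if $f_j(x)\le 0$ and $\bar f_j(x)=f_j(x)-\varphi(x)$ if $f_j(x)>0$, and $L(x,\lambda)=f_0(x)+\sum_{j\in I}\lambda_jf_j(x)$. **Algorithm.** Parameters: $\gamma,\eta,\varepsilon\in(0,1)$, $0<\theta<\sigma<1$, $0<\varrho<\sigma$, $\xi,\zeta>0$, $\alpha\in(0,\frac12)$, $\rho>1$, $\delta>2$, $\tau\in(2,3)$. Data: $x^0\in\mathbb R^n$ and a symmetric positive definite matrix $B_0$. Iteration $k$, with $\varphi_k=\varphi(x^k)$, is as follows. *Step 1.* Let $d_0^k$ minimize $g_0(x^k)^Td+\frac12d^TB_kd$ subject to $\bar f_j(x^k)+g_j(x^k)^Td\le0$ for all $j\in I$, and let $\lambda^k$ be a corresponding KKT multiplier vector. If $d_0^k=0$ and $\varphi_k=0$,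 stop. *Step 2.* Let $N_k=(g_1(x^k),\dots,g_m(x^k))$, $D^k=\mathrm{diag}(D^k_j)$ with $D_j^k=|\bar f_j(x^k)|\,(|\bar f_j(x^k)+g_j(x^k)^Td_0^k|+\|d_0^k\|)$, and $V_k=\begin{pmatrix}B_k&N_k\\N_k^T&-D^k\end{pmatrix}$. Solve $V_k\binom{d_1^k}{h_1^k}=\binom{0}{r}$ with $r_j=-\|d_0^k\|^\tau-\varphi_k^\sigma-\big(f_j(x^k+d_0^k)-f_j(x^k)-g_j(x^k)^Td_0^k\big)$, and put $d^k=d_0^k+d_1^k$. If $g_0(x^k)^Td_0^k\le\zeta\min\{-\|d_0^k\|^\delta,-\|d^k\|^\delta\}+\xi\varphi_k^\varrho$, go to Step 3; otherwise go to Step 4. *Step 3.* Let $t_k$ be the first $t$ in $1,\frac12,\frac14,\dots$ such that $$\left\{\begin{array}{ll}f_0(x^k+td^k)\le f_0(x^k)+\alpha t\,g_0(x^k)^Td_0^k+\rho(1-\alpha)t\varphi_k^\theta,&\\ f_j(x^k+td^k)\le\varphi_k-\alpha t(\|d_0^k\|^\tau+\varphi_k^\sigma)&\text{for all } j \text{ with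 } f_j(x^k)>0,\\ f_j(x^k+td^k)\le0&\text{for all } j\text{ with } f_j(x^k)\le0,\end{array}\right.\tag{14}$$ and go to Step 6; if no such $t\ge\varepsilon$ exists, go to Step 4. *Step 4.* Solve $V_k\binom{\tilde d^k}{\tilde h^k}=\binom{0}{s}$ with $s_j=-(\|d_0^k\|+\varphi_k^\sigma)$, and set $q^k=(1-\beta_k)d_0^k+\beta_k\tilde d^k$, where $\beta_k=\min\big\{1,\frac{(\theta-1)g_0(x^k)^Td_0^k+\varphi_k^\theta}{g_0(x^k)^T\tilde d^k-g_0(x^k)^Td_0^k}\big\}$ if $g_0(x^k)^T\tilde d^k>g_0(x^k)^Td_0^k$, and $\beta_k=1$ otherwise. *Step 5.* Let $t_k$ be the first $t$ in $1,\eta,\eta^2,\dots$ with $f_0(x^k+tq^k)\le f_0(x^k)+\gamma t\,g_0(x^k)^Tq^k+\rho(1-\gamma)t\varphi_k^\theta$, with $f_j(x^k+tq^k)\le\varphi_k-\gamma t\beta_k(\|d_0^k\|+\varphi_k^\sigma)$ whenever $f_j(x^k)>0$, and with $f_j(x^k+tq^k)\le0$ whenever $f_j(x^k)\le0$; then replace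 $d^k$ by $q^k$. *Step 6.* Choose a symmetric positive definite matrix $B_{k+1}$ (in any way), set $x^{k+1}=x^k+t_kd^k$, and return to Step 1 with $k+1$. **Theorem.** Suppose that the algorithm generates an infinite sequence $\{x^k\}$, and that: 1. for each $x\in\mathbb R^n$ the vectors $g_j(x)$ with $\bar f_j(x)=0$ are linearly independent; 2. there are constants $a,b>0$ with $a\|d\|^2\le d^TB_kd\le b\|d\|^2$ for all $d\in\mathbb R^n$ and all $k$; 3. $f_0,f_1,\dots,f_m$ are twice continuously differentiable, $\{x^k\}$ is bounded, and it has an accumulation point $x^*$ such that the KKT pair $(x^*,\lambda^*)$ of the problem satisfies the strong second-order sufficient condition: $d^T\nabla^2_{xx}L(x^*,\lambda^*)d>0$ for all $d\ne0$ with $g_j(x^*)^Td=0$ for every $j$ with $\lambda^*_j>0$; 4. $\|(\nabla^2_{xx}L(x^*,\lambda^*)-B_k)d_0^k\|=o(\|d_0^k\|)$ as $k\to\infty$. (Strict complementarity is not assumed.) Then for all sufficiently large $k$ the conditions (14), with $d^k=d_0^k+d_1^k$, hold for $t=1$. Moreover, for all sufficiently large $k$ the algorithm performs exactly Steps 1,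 2, 3, 6 (cycle I): Steps 4 and 5 are not performed, $t_k=1$ and $x^{k+1}=x^k+d_0^k+d_1^k$, so that the Maratos effect does not occur, and each such iteration solves one quadratic program and one system of linear equations. -/

import Mathlib

open Filter Topology

noncomputable section

/-- The problem: minimize `obj x` subject to `con j x ≤ 0` for `j = 1, …, m`, over `x ∈ ℝⁿ`. -/
structure NLProblem (n m : ℕ) where
  obj : EuclideanSpace ℝ (Fin n) → ℝ
  con : Fin m → EuclideanSpace ℝ (Fin n) → ℝ

/-- The product `B d` of a matrix and a vector of `ℝⁿ`. -/
def matVec {n : ℕ} (B : Matrix (Fin n) (Fin n) ℝ) (d : EuclideanSpace ℝ (Fin n)) :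
    EuclideanSpace ℝ (Fin n) :=
  Matrix.toEuclideanLin B d

namespace NLProblem

variable {n m : ℕ} (P : NLProblem n m)

/-- Gradient of the objective. -/
def g0 (x : EuclideanSpace ℝ (Fin n)) : EuclideanSpace ℝ (Fin n) := gradient P.obj x

/-- Gradient of the `j`-th constraint function. -/
def g (j : Fin m) (x : EuclideanSpace ℝ (Fin n)) : EuclideanSpace ℝ (Fin n) :=
  gradient (P.con j) x

/-- `φ(x) = max {0, f₁(x), …, f_m(x)}`. -/
def phi (x : EuclideanSpace ℝ (Fin n)) : ℝ :=
  Finset.univ.fold max 0 (fun j => P.con j x)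

/-- `f̄_j(x) = f_j(x)` if `f_j(x) ≤ 0`, and `f_j(x) - φ(x)` otherwise. -/
def fbar (j : Fin m) (x : EuclideanSpace ℝ (Fin n)) : ℝ :=
  if P.con j x ≤ 0 then P.con j x else P.con j x - P.phi x

/-- For every `x ∈ ℝⁿ` the gradients `g_j(x)` with `f̄_j(x) = 0` are linearly independent. -/
def GradientsIndependent : Prop :=
  ∀ x, LinearIndepOn ℝ (fun j => P.g j x) {j | P.fbar j x = 0}

/-- The Lagrangian `L(x, lam) = f₀(x) + ∑ⱼ lamⱼ fⱼ(x)`. -/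
def lagrangian (lam : Fin m → ℝ) (x : EuclideanSpace ℝ (Fin n)) : ℝ :=
  P.obj x + ∑ j, lam j * P.con j x

/-- The Hessian `∇²ₓₓ L(x, lam)`, as the derivative of the gradient. -/
def hessL (x : EuclideanSpace ℝ (Fin n)) (lam : Fin m → ℝ) :
    EuclideanSpace ℝ (Fin n) →L[ℝ] EuclideanSpace ℝ (Fin n) :=
  fderiv ℝ (gradient (P.lagrangian lam)) x

/-- `(x, lam)` is a Karush-Kuhn-Tucker pair of the problem. -/
structure IsKKTPair (x : EuclideanSpace ℝ (Fin n)) (lam : Fin m → ℝ) : Prop where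
  stationary : P.g0 x + ∑ j, lam j • P.g j x = 0
  feasible : ∀ j, P.con j x ≤ 0
  nonneg : ∀ j, 0 ≤ lam j
  complementary : ∀ j, lam j * P.con j x = 0

/-- Strong second-order sufficient condition: `dᵀ ∇²L(x, lam) d > 0` for all `d ≠ 0` with
`g_j(x)ᵀ d = 0` whenever `lam j > 0`. -/
def StrongSecondOrder (x : EuclideanSpace ℝ (Fin n)) (lam : Fin m → ℝ) : Prop :=
  ∀ d : EuclideanSpace ℝ (Fin n), d ≠ 0 → (∀ j, 0 < lam j → inner ℝ (P.g j x) d = 0) →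
    0 < inner ℝ d (P.hessL x lam d)

/-! ### The quadratic program and the linear systems -/

/-- Feasibility of `d` for the quadratic program at `x`. -/
def QPFeasible (x d : EuclideanSpace ℝ (Fin n)) : Prop :=
  ∀ j, P.fbar j x + inner ℝ (P.g j x) d ≤ 0

/-- Objective `g₀(x)ᵀ d + ½ dᵀ B d` of the quadratic program. -/
def qpObj (x : EuclideanSpace ℝ (Fin n)) (B : Matrix (Fin n) (Fin n) ℝ)
    (d : EuclideanSpace ℝ (Fin n)) : ℝ :=
  inner ℝ (P.g0 x) d + 1 / 2 * inner ℝ d (matVec B d)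

/-- `d` is an optimal solution of the quadratic program. -/
def IsQPSolution (x : EuclideanSpace ℝ (Fin n)) (B : Matrix (Fin n) (Fin n) ℝ)
    (d : EuclideanSpace ℝ (Fin n)) : Prop :=
  P.QPFeasible x d ∧ ∀ d', P.QPFeasible x d' → P.qpObj x B d ≤ P.qpObj x B d'

/-- `lam` is a KKT multiplier vector of the quadratic program at its solution `d`. -/
structure IsQPMultiplier (x : EuclideanSpace ℝ (Fin n)) (B : Matrix (Fin n) (Fin n) ℝ)
    (d : EuclideanSpace ℝ (Fin n)) (lam : Fin m → ℝ) : Prop where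
  stationary : P.g0 x + matVec B d + ∑ j, lam j • P.g j x = 0
  nonneg : ∀ j, 0 ≤ lam j
  complementary : ∀ j, lam j * (P.fbar j x + inner ℝ (P.g j x) d) = 0

/-- The matrix `N = (g₁(x), …, g_m(x))`, whose columns are the constraint gradients. -/
def gradMatrix (x : EuclideanSpace ℝ (Fin n)) : Matrix (Fin n) (Fin m) ℝ :=
  Matrix.of fun i j => P.g j x i

/-- `D_j = |f̄_j(x)| (|f̄_j(x) + g_j(x)ᵀ d₀| + ‖d₀‖)`. -/
def diagD (x d0 : EuclideanSpace ℝ (Fin n)) (j : Fin m) : ℝ :=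
  |P.fbar j x| * (|P.fbar j x + inner ℝ (P.g j x) d0| + ‖d0‖)

/-- The common coefficient matrix `V = [[B, N], [Nᵀ, -D]]` of the linear systems. -/
def coeffV (x : EuclideanSpace ℝ (Fin n)) (B : Matrix (Fin n) (Fin n) ℝ)
    (d0 : EuclideanSpace ℝ (Fin n)) : Matrix (Fin n ⊕ Fin m) (Fin n ⊕ Fin m) ℝ :=
  Matrix.fromBlocks B (P.gradMatrix x) (P.gradMatrix x).transpose
    (-Matrix.diagonal (P.diagD x d0))

/-- `(d, h)` solves the linear system `V (d, h) = (0, r)`. -/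
def SolvesSLE (x : EuclideanSpace ℝ (Fin n)) (B : Matrix (Fin n) (Fin n) ℝ)
    (d0 : EuclideanSpace ℝ (Fin n)) (r : Fin m → ℝ)
    (d : EuclideanSpace ℝ (Fin n)) (h : Fin m → ℝ) : Prop :=
  (P.coeffV x B d0).mulVec (Sum.elim (fun i => d i) h) = Sum.elim (fun _ => 0) r

end NLProblem

/-- The parameters of the algorithm, with their admissible ranges. -/
structure AlgParams where
  (gamma eta eps theta sigma varrho xi zeta alpha rho delta tau : ℝ)
  gamma_mem : gamma ∈ Set.Ioo (0 : ℝ) 1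
  eta_mem : eta ∈ Set.Ioo (0 : ℝ) 1
  eps_mem : eps ∈ Set.Ioo (0 : ℝ) 1
  theta_pos : 0 < theta
  theta_lt_sigma : theta < sigma
  sigma_lt_one : sigma < 1
  varrho_pos : 0 < varrho
  varrho_lt_sigma : varrho < sigma
  xi_pos : 0 < xi
  zeta_pos : 0 < zeta
  alpha_mem : alpha ∈ Set.Ioo (0 : ℝ) (1 / 2)
  one_lt_rho : 1 < rho
  two_lt_delta : 2 < delta
  tau_mem : tau ∈ Set.Ioo (2 : ℝ) 3

namespace NLProblem

variable {n m : ℕ} (P : NLProblem n m) (A : AlgParams)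

/-- Right-hand side (lower block) of the system for the higher-order correction `d₁`:
`-(‖d₀‖^τ + φ(x)^σ) - (f_j(x + d₀) - f_j(x) - g_j(x)ᵀ d₀)`. -/
def rhsCorrection (x d0 : EuclideanSpace ℝ (Fin n)) (j : Fin m) : ℝ :=
  -(‖d0‖ ^ A.tau + P.phi x ^ A.sigma)
    - (P.con j (x + d0) - P.con j x - inner ℝ (P.g j x) d0)

/-- Right-hand side (lower block) of the system for `d̃`: `-(‖d₀‖ + φ(x)^σ)`. -/
def rhsTilde (x d0 : EuclideanSpace ℝ (Fin n)) (_ : Fin m) : ℝ :=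
  -(‖d0‖ + P.phi x ^ A.sigma)

/-- The test of Step 2:
`g₀(x)ᵀ d₀ ≤ ζ min {-‖d₀‖^δ, -‖d‖^δ} + ξ φ(x)^ϱ`. -/
def Step2Test (x d0 d : EuclideanSpace ℝ (Fin n)) : Prop :=
  inner ℝ (P.g0 x) d0 ≤
    A.zeta * min (-(‖d0‖ ^ A.delta)) (-(‖d‖ ^ A.delta)) + A.xi * P.phi x ^ A.varrho

/-- The line-search conditions of Step 3 at `x`, with direction `d` and trial step `t`. -/
structure Step3Conditions (x d0 d : EuclideanSpace ℝ (Fin n)) (t : ℝ) : Prop where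
  objective : P.obj (x + t • d) ≤
    P.obj x + A.alpha * t * inner ℝ (P.g0 x) d0 + A.rho * (1 - A.alpha) * t * P.phi x ^ A.theta
  violated : ∀ j, 0 < P.con j x →
    P.con j (x + t • d) ≤ P.phi x - A.alpha * t * (‖d0‖ ^ A.tau + P.phi x ^ A.sigma)
  satisfied : ∀ j, P.con j x ≤ 0 → P.con j (x + t • d) ≤ 0

/-- Step 3 succeeds with steplength `t`: `t` is the first element of `1, 1/2, 1/4, …` that
satisfies the line-search conditions, and it is not smaller than `ε`. -/
def Step3Succeeds (x d0 d : EuclideanSpace ℝ (Fin n)) (t : ℝ) : Prop :=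
  ∃ i : ℕ, t = (1 / 2 : ℝ) ^ i ∧ A.eps ≤ t ∧ P.Step3Conditions A x d0 d t ∧
    ∀ i' < i, ¬ P.Step3Conditions A x d0 d ((1 / 2 : ℝ) ^ i')

/-- Step 3 fails: no element `t ≥ ε` of `1, 1/2, 1/4, …` satisfies the conditions. -/
def Step3Fails (x d0 d : EuclideanSpace ℝ (Fin n)) : Prop :=
  ∀ i : ℕ, A.eps ≤ (1 / 2 : ℝ) ^ i → ¬ P.Step3Conditions A x d0 d ((1 / 2 : ℝ) ^ i)

/-- The weight `β` of the convex combination in Step 4. -/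
def beta (x d0 dt : EuclideanSpace ℝ (Fin n)) : ℝ :=
  if inner ℝ (P.g0 x) d0 < inner ℝ (P.g0 x) dt then
    min 1 (((A.theta - 1) * inner ℝ (P.g0 x) d0 + P.phi x ^ A.theta) /
      (inner ℝ (P.g0 x) dt - inner ℝ (P.g0 x) d0))
  else 1

/-- The line-search conditions of Step 5 at `x`, with direction `q`, weight `b`, step `t`. -/
structure Step5Conditions (x d0 q : EuclideanSpace ℝ (Fin n)) (b t : ℝ) : Prop where
  objective : P.obj (x + t • q) ≤
    P.obj x + A.gamma * t * inner ℝ (P.g0 x) q + A.rho * (1 - A.gamma) * t * P.phi x ^ A.theta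
  violated : ∀ j, 0 < P.con j x →
    P.con j (x + t • q) ≤ P.phi x - A.gamma * t * b * (‖d0‖ + P.phi x ^ A.sigma)
  satisfied : ∀ j, P.con j x ≤ 0 → P.con j (x + t • q) ≤ 0

/-- Steps 4 and 5 produce the direction `q` and the steplength `t`. -/
def Steps45 (x : EuclideanSpace ℝ (Fin n)) (B : Matrix (Fin n) (Fin n) ℝ)
    (d0 q : EuclideanSpace ℝ (Fin n)) (t : ℝ) : Prop :=
  ∃ (dt : EuclideanSpace ℝ (Fin n)) (ht : Fin m → ℝ),
    P.SolvesSLE x B d0 (P.rhsTilde A x d0) dt ht ∧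
    q = (1 - P.beta A x d0 dt) • d0 + P.beta A x d0 dt • dt ∧
    ∃ i : ℕ, t = A.eta ^ i ∧ P.Step5Conditions A x d0 q (P.beta A x d0 dt) t ∧
      ∀ i' < i, ¬ P.Step5Conditions A x d0 q (P.beta A x d0 dt) (A.eta ^ i')

/-- One passage through the algorithm at `(x, B)`, after `d₀` and `d₁` have been computed in
Steps 1 and 2. The last three arguments are the list of the numbers of the steps performed,
the steplength, and the final direction. -/
inductive Iteration (x : EuclideanSpace ℝ (Fin n)) (B : Matrix (Fin n) (Fin n) ℝ)
    (d0 d1 : EuclideanSpace ℝ (Fin n)) :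
    List ℕ → ℝ → EuclideanSpace ℝ (Fin n) → Prop where
  | cycleI {t : ℝ} (test : P.Step2Test A x d0 (d0 + d1))
      (success : P.Step3Succeeds A x d0 (d0 + d1) t) :
      Iteration x B d0 d1 [1, 2, 3, 6] t (d0 + d1)
  | step3Failed {t : ℝ} {q : EuclideanSpace ℝ (Fin n)}
      (test : P.Step2Test A x d0 (d0 + d1)) (failure : P.Step3Fails A x d0 (d0 + d1))
      (steps45 : P.Steps45 A x B d0 q t) :
      Iteration x B d0 d1 [1, 2, 3, 4, 5, 6] t q
  | testFailed {t : ℝ} {q : EuclideanSpace ℝ (Fin n)}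
      (test : ¬ P.Step2Test A x d0 (d0 + d1)) (steps45 : P.Steps45 A x B d0 q t) :
      Iteration x B d0 d1 [1, 2, 4, 5, 6] t q

/-- An infinite run of the algorithm, that is, one which never stops in Step 1. The initial point
`x 0` is arbitrary and the symmetric positive definite matrices `B k` are updated in an
arbitrary way. -/
structure Run where
  x : ℕ → EuclideanSpace ℝ (Fin n)
  B : ℕ → Matrix (Fin n) (Fin n) ℝ
  d0 : ℕ → EuclideanSpace ℝ (Fin n)
  lam : ℕ → Fin m → ℝ
  d1 : ℕ → EuclideanSpace ℝ (Fin n)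
  h1 : ℕ → Fin m → ℝ
  /-- the numbers of the steps performed in iteration `k`, in order -/
  trace : ℕ → List ℕ
  /-- the steplength -/
  t : ℕ → ℝ
  /-- the direction along which the step is finally taken -/
  dir : ℕ → EuclideanSpace ℝ (Fin n)
  posDef : ∀ k, (B k).PosDef
  step1_solution : ∀ k, P.IsQPSolution (x k) (B k) (d0 k)
  step1_multiplier : ∀ k, P.IsQPMultiplier (x k) (B k) (d0 k) (lam k)
  step1_continue : ∀ k, ¬ (d0 k = 0 ∧ P.phi (x k) = 0)
  step2_correction : ∀ k,
    P.SolvesSLE (x k) (B k) (d0 k) (P.rhsCorrection A (x k) (d0 k)) (d1 k) (h1 k)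
  iteration : ∀ k, P.Iteration A (x k) (B k) (d0 k) (d1 k) (trace k) (t k) (dir k)
  step6_update : ∀ k, x (k + 1) = x k + t k • dir k

end NLProblem

/-- Number of quadratic programs solved in an iteration: one in each passage of Step 1. -/
def qpCount (trace : List ℕ) : ℕ := trace.count 1

/-- Number of linear systems solved in an iteration: one in each passage of Steps 2 and 4. -/
def sleCount (trace : List ℕ) : ℕ := trace.count 2 + trace.count 4

end

/-! Global convergence comes before the local analysis. Independence of the gradients on `fbar = 0`,
made uniform on compact sets (`exists_gram_lower_bound`), and the uniform bounds on `B` make the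
linear systems uniformly solvable (`exists_sle_bound`), so every direction is controlled by `‖d0‖`
and `φ`. Steps 3 and 5 both give a decrease of `f₀` by `c t ‖d0‖²`, up to an increase of order `t
φ^θ`, and a decrease of `φ` by `c t φ^σ`. Since `θ < σ < 1`, adding a multiple of `φ^(1+θ-σ)` to
`f₀` gives a merit function that is eventually decreasing, so `t (‖d0‖² + φ^θ) → 0`
(`tendsto_mul_add_rpow_of_decrease`). Steplengths cannot vanish away from stationarity
(`exists_step5_threshold`), hence `d0 → 0` and `φ → 0`. Cluster points are then KKT points, the
strong second-order condition isolates `x*` (`IsKKTPair.isolated`), and vanishing increments force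
`x^k → x*` and `λ^k → λ*`. Locally, `d1` replaces the linearization of each `f_j` by its value at `x
+ d0` and pushes it further down by `‖d0‖^τ + φ^σ`. As `τ < 3`, this margin beats the remaining
errors of order `‖d0‖ ‖d1‖` and `‖d1‖²` (`eventually_constraint_decrease`). For the objective,
stationarity of the quadratic program and the equations for `d1` convert `g₀ᵀd1` into the curvature
of the constraints. The second-order term thus becomes `½ d0ᵀ∇²L d0`, which is `½ d0ᵀB d0` up to
`o(‖d0‖² + φ^θ)` (`isLittleO_objective`); `α < ½` and `g₀ᵀd0 ≤ -d0ᵀB d0` give acceptance of `t = 1`.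
The test of Step 2 holds eventually because `δ > 2` and `ϱ < σ`. -/

section Calculus

/-! ### Taylor estimates. -/

variable {E : Type*} [NormedAddCommGroup E] [InnerProductSpace ℝ E] [CompleteSpace E]

theorem contDiff_gradient {f : E → ℝ} (hf : ContDiff ℝ 2 f) : ContDiff ℝ 1 (gradient f) := by
  have h : ContDiff ℝ 1 (fderiv ℝ f) := hf.fderiv_right (by norm_num)
  exact ((InnerProductSpace.toDual ℝ E).symm : StrongDual ℝ E ≃ₗᵢ[ℝ] E).contDiff.comp h

theorem hasDerivAt_comp_segment {f : E → ℝ} (hf : Differentiable ℝ f) (x d : E) (s : ℝ) :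
    HasDerivAt (fun s : ℝ => f (x + s • d)) (inner ℝ (gradient f (x + s • d)) d) s := by
  have h1 : HasDerivAt (fun s : ℝ => x + s • d) d s := by
    simpa using ((hasDerivAt_id s).smul_const d).const_add x
  have h2 := (hf (x + s • d)).hasGradientAt.hasFDerivAt
  exact (h2.comp_hasDerivAt s h1).congr_deriv (by simp)

/-- A mean value estimate for the second order Taylor remainder. -/
theorem abs_taylor_remainder_le {f : E → ℝ} (hf : Differentiable ℝ f) (x d : E)
    (H : E →L[ℝ] E) {C : ℝ}
    (hC : ∀ s ∈ Set.Icc (0 : ℝ) 1, ‖gradient f (x + s • d) - gradient f x - s • H d‖ ≤ C) :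
    |f (x + d) - f x - inner ℝ (gradient f x) d - 1 / 2 * inner ℝ d (H d)| ≤ C * ‖d‖ := by
  -- The mean value inequality is applied to the remainder along the segment. Only the form `⟪d, H
  -- d⟫` enters, so `H` need be neither symmetric nor a derivative.
  have key : ∀ s ∈ Set.Icc (0 : ℝ) 1, HasDerivWithinAt
      (fun s : ℝ => f (x + s • d) - s * inner ℝ (gradient f x) d - s ^ 2 * (1 / 2 * inner ℝ d (H d)))
      (inner ℝ (gradient f (x + s • d) - gradient f x - s • H d) d) (Set.Icc 0 1) s := by
    intro s _
    apply HasDerivAt.hasDerivWithinAt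
    have h1 := hasDerivAt_comp_segment hf x d s
    have h2 := (hasDerivAt_id s).mul_const (inner ℝ (gradient f x) d)
    have h3 := (hasDerivAt_pow 2 s).mul_const (1 / 2 * inner ℝ d (H d))
    refine ((h1.sub h2).sub h3).congr_deriv ?_
    simp only [inner_sub_left, inner_smul_left, real_inner_comm d (H d)]
    simp
    ring
  have bound : ∀ s ∈ Set.Icc (0 : ℝ) 1,
      ‖inner ℝ (gradient f (x + s • d) - gradient f x - s • H d) d‖ ≤ C * ‖d‖ := by
    intro s hs
    exact (norm_inner_le_norm _ _).trans (mul_le_mul_of_nonneg_right (hC s hs) (norm_nonneg _))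
  have := (convex_Icc (0 : ℝ) 1).norm_image_sub_le_of_norm_hasDerivWithin_le key bound
    (Set.left_mem_Icc.2 zero_le_one) (Set.right_mem_Icc.2 zero_le_one)
  simp only [Real.norm_eq_abs, one_smul, zero_smul, add_zero, sub_zero, one_mul, zero_mul,
    one_pow, abs_one, mul_one] at this
  convert this using 2
  ring

theorem exists_gradient_lipschitz [FiniteDimensional ℝ E] {f : E → ℝ} (hf : ContDiff ℝ 2 f)
    (r : ℝ) : ∃ C, 0 ≤ C ∧ ∀ x y : E, ‖x‖ ≤ r → ‖y‖ ≤ r →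
      ‖gradient f y - gradient f x‖ ≤ C * ‖y - x‖ := by
  have hg := contDiff_gradient hf
  have hK : IsCompact (Metric.closedBall (0 : E) r) := isCompact_closedBall _ _
  obtain ⟨C, hC⟩ := hK.exists_bound_of_continuousOn
    (hg.continuous_fderiv (by norm_num)).continuousOn
  refine ⟨max C 0, le_max_right _ _, fun x y hx hy => ?_⟩
  exact (convex_closedBall (0 : E) r).norm_image_sub_le_of_norm_fderiv_le
    (fun z _ => (hg.differentiable (by norm_num)) z)
    (fun z hz => (hC z hz).trans (le_max_left _ _)) (by simpa using hx) (by simpa using hy)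

theorem exists_taylor_bound [FiniteDimensional ℝ E] {f : E → ℝ} (hf : ContDiff ℝ 2 f)
    (r : ℝ) : ∃ C, 0 ≤ C ∧ ∀ x d : E, ‖x‖ ≤ r → ‖x + d‖ ≤ r →
      ‖gradient f (x + d) - gradient f x‖ ≤ C * ‖d‖ ∧
      |f (x + d) - f x - inner ℝ (gradient f x) d| ≤ C * ‖d‖ ^ 2 := by
  obtain ⟨C, hC0, hC⟩ := exists_gradient_lipschitz hf r
  refine ⟨C, hC0, fun x d hx hy => ⟨by simpa using hC x (x + d) hx hy, ?_⟩⟩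
  -- With `H = 0` the second-order estimate becomes the first-order one.
  have := abs_taylor_remainder_le (hf.differentiable (by norm_num)) x d 0 (C := C * ‖d‖) ?_
  · simpa [sq, mul_assoc] using this
  · intro s hs
    have hmem : x + s • d ∈ Metric.closedBall (0 : E) r := by
      have := (convex_closedBall (0 : E) r).add_smul_sub_mem
        (x := x) (y := x + d) (by simpa using hx) (by simpa using hy) hs
      simpa using this
    have := hC x (x + s • d) hx (by simpa using hmem)
    refine le_trans (by simpa using this) ?_
    rw [norm_smul, Real.norm_of_nonneg hs.1]
    nlinarith [hs.2, norm_nonneg d, mul_nonneg hC0 (norm_nonneg d)]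

/-- Strict differentiability of the gradient at `z` makes the expansion uniform in the base point
`x`, with the Hessian frozen at `z`. This suits expansions at `x^k` with the Hessian at `x*`. -/
theorem taylor_littleO {f : E → ℝ} (hf : ContDiff ℝ 2 f) (z : E) {ε : ℝ} (hε : 0 < ε) :
    ∃ r > 0, ∀ x d : E, ‖x - z‖ < r → ‖d‖ < r →
      |f (x + d) - f x - inner ℝ (gradient f x) d
        - 1 / 2 * inner ℝ d (fderiv ℝ (gradient f) z d)| ≤ ε * ‖d‖ ^ 2 := by
  have hs : HasStrictFDerivAt (gradient f) (fderiv ℝ (gradient f) z) z :=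
    (contDiff_gradient hf).contDiffAt.hasStrictFDerivAt (by norm_num)
  have h := hs.isLittleO.def hε
  rw [Metric.eventually_nhds_iff] at h
  obtain ⟨r, hr, h⟩ := h
  refine ⟨r / 2, by positivity, fun x d hx hd => ?_⟩
  have := abs_taylor_remainder_le (hf.differentiable (by norm_num)) x d
    (fderiv ℝ (gradient f) z) (C := ε * ‖d‖) ?_
  · simpa [sq, mul_assoc] using this
  · intro s hs
    have hsd : ‖s • d‖ ≤ ‖d‖ := by
      rw [norm_smul, Real.norm_of_nonneg hs.1]
      exact mul_le_of_le_one_left (norm_nonneg _) hs.2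
    have h1 : dist ((x + s • d, x) : E × E) (z, z) < r := by
      rw [Prod.dist_eq, max_lt_iff, dist_eq_norm, dist_eq_norm]
      constructor
      · have : x + s • d - z = (x - z) + s • d := by abel
        simp only [this]
        linarith [norm_add_le (x - z) (s • d)]
      · simp only; linarith
    have := h h1
    simp only [add_sub_cancel_left, map_smul] at this
    exact this.trans (mul_le_mul_of_nonneg_left hsd hε.le)

end Calculus

/-! ### Operator bounds from quadratic form bounds. -/

section QuadraticForm

variable {n : ℕ}

theorem matVec_add (B : Matrix (Fin n) (Fin n) ℝ) (u v : EuclideanSpace ℝ (Fin n)) :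
    matVec B (u + v) = matVec B u + matVec B v := map_add _ _ _

theorem matVec_sub (B : Matrix (Fin n) (Fin n) ℝ) (u v : EuclideanSpace ℝ (Fin n)) :
    matVec B (u - v) = matVec B u - matVec B v := map_sub _ _ _

theorem inner_matVec_comm {B : Matrix (Fin n) (Fin n) ℝ} (hB : B.IsHermitian)
    (u v : EuclideanSpace ℝ (Fin n)) :
    inner ℝ u (matVec B v) = inner ℝ v (matVec B u) := by
  have := Matrix.isSymmetric_toEuclideanLin_iff.2 hB
  rw [real_inner_comm]
  exact this v u

theorem norm_matVec_le {B : Matrix (Fin n) (Fin n) ℝ} (hB : B.IsHermitian) {b : ℝ}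
    (h0 : ∀ d : EuclideanSpace ℝ (Fin n), 0 ≤ inner ℝ d (matVec B d))
    (hb : ∀ d : EuclideanSpace ℝ (Fin n), inner ℝ d (matVec B d) ≤ b * ‖d‖ ^ 2)
    (v : EuclideanSpace ℝ (Fin n)) : ‖matVec B v‖ ≤ b * ‖v‖ := by
  rcases eq_or_ne v 0 with rfl | hv
  · simp [matVec]
  rcases eq_or_ne (matVec B v) 0 with hz | hz
  · have := (h0 v).trans (hb v)
    have hv' : 0 < ‖v‖ ^ 2 := by positivity
    have hb0 : 0 ≤ b := by
      by_contra hneg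
      nlinarith
    rw [hz, norm_zero]
    positivity
  have hv' : 0 < ‖v‖ := norm_pos_iff.2 hv
  have hz' : 0 < ‖matVec B v‖ := norm_pos_iff.2 hz
  -- Polarization with the multiple of `B v` that has the norm of `v`: the form at `u - v` is
  -- dropped by nonnegativity, and the form at `u + v` is at most `4 b ‖v‖²`.
  set u := (‖v‖ / ‖matVec B v‖) • matVec B v with hu
  have hun : ‖u‖ = ‖v‖ := by
    rw [hu, norm_smul, Real.norm_of_nonneg (by positivity)]
    field_simp
  have huv : inner ℝ u (matVec B v) = ‖v‖ * ‖matVec B v‖ := by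
    rw [hu, inner_smul_left, real_inner_self_eq_norm_sq]
    simp
    field_simp
  have hpol : 4 * inner ℝ u (matVec B v) =
      inner ℝ (u + v) (matVec B (u + v)) - inner ℝ (u - v) (matVec B (u - v)) := by
    simp only [matVec_add, matVec_sub, inner_add_left, inner_add_right, inner_sub_left,
      inner_sub_right, inner_matVec_comm hB v u]
    ring
  have h1 := h0 (u - v)
  have h2 := hb (u + v)
  have hb0 : 0 ≤ b := by
    have := (h0 v).trans (hb v)
    by_contra hneg
    nlinarith [pow_pos hv' 2]
  have h3 : ‖u + v‖ ^ 2 ≤ 4 * ‖v‖ ^ 2 := by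
    have := norm_add_le u v
    rw [hun] at this
    nlinarith [norm_nonneg (u + v)]
  have h4 : ‖v‖ * ‖matVec B v‖ ≤ ‖v‖ * (b * ‖v‖) := by
    nlinarith [mul_le_mul_of_nonneg_left h3 hb0]
  exact le_of_mul_le_mul_left h4 hv'

end QuadraticForm

/-! ### Constraint violation and uniform independence of the gradients. -/

namespace NLProblem

variable {n m : ℕ} {P : NLProblem n m}

theorem phi_le_iff {x : EuclideanSpace ℝ (Fin n)} {c : ℝ} :
    P.phi x ≤ c ↔ 0 ≤ c ∧ ∀ j, P.con j x ≤ c := by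
  simp [phi, Finset.fold_max_le]

theorem phi_nonneg (x : EuclideanSpace ℝ (Fin n)) : 0 ≤ P.phi x := (phi_le_iff.1 le_rfl).1

theorem con_le_phi (j : Fin m) (x : EuclideanSpace ℝ (Fin n)) : P.con j x ≤ P.phi x :=
  (phi_le_iff.1 le_rfl).2 j

theorem continuous_phi (hf : ∀ j, Continuous (P.con j)) : Continuous P.phi := by
  have : ∀ s : Finset (Fin m), Continuous fun x => s.fold max 0 (fun j => P.con j x) := by
    intro s
    induction s using Finset.induction_on with
    | empty => simpa using continuous_const
    | insert j s hj ih =>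
      simp only [Finset.fold_insert hj]
      exact (hf j).max ih
  exact this Finset.univ

theorem fbar_nonpos (j : Fin m) (x : EuclideanSpace ℝ (Fin n)) : P.fbar j x ≤ 0 := by
  unfold fbar
  split_ifs with h
  · exact h
  · linarith [con_le_phi (P := P) j x]

theorem abs_fbar_sub_con_le (j : Fin m) (x : EuclideanSpace ℝ (Fin n)) :
    |P.fbar j x - P.con j x| ≤ P.phi x := by
  unfold fbar
  split_ifs with h
  · simpa using phi_nonneg x
  · simp [abs_of_nonneg (phi_nonneg (P := P) x)]

/-- Uniform nondegeneracy of the constraint gradients, weighted by the constraint values. -/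
theorem exists_gram_lower_bound (hg : ∀ j, Continuous (P.g j)) (hf : ∀ j, Continuous (P.con j))
    (hindep : P.GradientsIndependent) {S : Set (EuclideanSpace ℝ (Fin n))} (hS : IsCompact S) :
    ∃ c > 0, ∀ x ∈ S, ∀ h : Fin m → ℝ,
      c * ∑ j, h j ^ 2 ≤ ‖∑ j, h j • P.g j x‖ ^ 2 + ∑ j, (P.fbar j x * h j) ^ 2 := by
  -- `fbar` jumps where `f_j` changes sign at infeasible points. The function `ψ` is a continuous
  -- minorant of `|fbar|` that vanishes only where `fbar` does, so compactness can be used.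
  set ψ : Fin m → EuclideanSpace ℝ (Fin n) → ℝ :=
    fun j x => min |P.con j x| |P.con j x - P.phi x| with hψ
  have hψc : ∀ j, Continuous (ψ j) := fun j =>
    (hf j).abs.min ((hf j).sub (continuous_phi hf)).abs
  have hψ0 : ∀ j x, 0 ≤ ψ j x := fun j x => le_min (abs_nonneg _) (abs_nonneg _)
  have hψle : ∀ j x, ψ j x ≤ |P.fbar j x| := by
    intro j x
    unfold fbar
    split_ifs
    · exact min_le_left _ _
    · exact min_le_right _ _
  have hψz : ∀ j x, ψ j x = 0 → P.fbar j x = 0 := by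
    intro j x h
    have hp := phi_nonneg (P := P) x
    unfold fbar
    rcases min_choice |P.con j x| |P.con j x - P.phi x| with h' | h'
    · have h1 : P.con j x = 0 := abs_eq_zero.1 (h'.symm.trans h)
      simp [h1]
    · have h1 : P.con j x - P.phi x = 0 := abs_eq_zero.1 (h'.symm.trans h)
      split_ifs <;> linarith
  let F : EuclideanSpace ℝ (Fin n) × EuclideanSpace ℝ (Fin m) → ℝ := fun p =>
    ‖∑ j, p.2 j • P.g j p.1‖ ^ 2 + ∑ j, (ψ j p.1 * p.2 j) ^ 2
  have hFc : Continuous F := by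
    have h1 : ∀ j, Continuous fun p : EuclideanSpace ℝ (Fin n) × EuclideanSpace ℝ (Fin m) =>
        p.2 j := fun j => by fun_prop
    have h2 : ∀ j, Continuous fun p : EuclideanSpace ℝ (Fin n) × EuclideanSpace ℝ (Fin m) =>
        P.g j p.1 := fun j => (hg j).comp continuous_fst
    have h3 : ∀ j, Continuous fun p : EuclideanSpace ℝ (Fin n) × EuclideanSpace ℝ (Fin m) =>
        ψ j p.1 := fun j => (hψc j).comp continuous_fst
    exact ((continuous_finsetSum _ fun j _ => (h1 j).smul (h2 j)).norm.pow 2).add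
      (continuous_finsetSum _ fun j _ => ((h3 j).mul (h1 j)).pow 2)
  -- At a zero of `F` the coefficients are supported where `fbar = 0`; there the gradients are
  -- independent, so `h = 0`, which the sphere excludes.
  have hpos : ∀ p ∈ S ×ˢ Metric.sphere (0 : EuclideanSpace ℝ (Fin m)) 1, 0 < F p := by
    rintro ⟨x, h⟩ ⟨-, hh⟩
    have hnn : 0 ≤ F (x, h) := by positivity
    refine lt_of_le_of_ne hnn fun h0 => ?_
    have hz : ‖∑ j, h j • P.g j x‖ ^ 2 = 0 ∧ ∑ j, (ψ j x * h j) ^ 2 = 0 :=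
      (add_eq_zero_iff_of_nonneg (by positivity) (by positivity)).1 h0.symm
    have hsum : ∑ j, h j • P.g j x = 0 := by simpa using hz.1
    have hcoef : ∀ j, ψ j x * h j = 0 := fun j => by
      have := (Finset.sum_eq_zero_iff_of_nonneg (fun j _ => sq_nonneg _)).1 hz.2 j (by simp)
      simpa using this
    have hoff : ∀ j, P.fbar j x ≠ 0 → h j = 0 := fun j hj =>
      (mul_eq_zero.1 (hcoef j)).resolve_left fun hc => hj (hψz j x hc)
    have hzero : ∀ j, h j = 0 := by
      intro j
      by_cases hj : P.fbar j x = 0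
      · have hli := linearIndepOn_iff'.1 (hindep x) (Finset.univ.filter fun j => P.fbar j x = 0)
          (fun j => h j) (by intro i hi; simpa using hi) ?_ j (by simpa using hj)
        · exact hli
        · rw [Finset.sum_filter_of_ne]
          · exact hsum
          · intro i _ hi
            by_contra hne
            exact hi (by rw [hoff i hne, zero_smul])
      · exact hoff j hj
    have : h = 0 := by ext j; simpa using hzero j
    simp [this] at hh
  obtain ⟨c, hc, hcF⟩ := (hS.prod (isCompact_sphere (0 : EuclideanSpace ℝ (Fin m)) 1)).exists_forall_le'
    hFc.continuousOn hpos
  refine ⟨c, hc, fun x hx h => ?_⟩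
  have hψfbar : ∑ j, (ψ j x * h j) ^ 2 ≤ ∑ j, (P.fbar j x * h j) ^ 2 := by
    refine Finset.sum_le_sum fun j _ => ?_
    rw [mul_pow, mul_pow]
    refine mul_le_mul_of_nonneg_right ?_ (sq_nonneg _)
    rw [← sq_abs (P.fbar j x)]
    exact pow_le_pow_left₀ (hψ0 j x) (hψle j x) 2
  refine le_trans ?_ (add_le_add_right hψfbar _)
  -- Both sides are quadratic in `h`, so the bound on the unit sphere extends by scaling.
  set v : EuclideanSpace ℝ (Fin m) := WithLp.toLp 2 h with hv
  have hvn : ‖v‖ ^ 2 = ∑ j, h j ^ 2 := by simp [EuclideanSpace.norm_sq_eq, hv]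
  rw [← hvn]
  rcases eq_or_ne v 0 with h0 | h0
  · rw [h0]
    simp only [norm_zero, ne_eq, OfNat.ofNat_ne_zero, not_false_eq_true, zero_pow, mul_zero]
    positivity
  have hvp : 0 < ‖v‖ := norm_pos_iff.2 h0
  have hmem : (x, ‖v‖⁻¹ • v) ∈ S ×ˢ Metric.sphere (0 : EuclideanSpace ℝ (Fin m)) 1 :=
    ⟨hx, by simp [norm_smul, hvp.ne']⟩
  have h1 := hcF _ hmem
  have h2 : F (x, ‖v‖⁻¹ • v) =
      (‖v‖⁻¹) ^ 2 * (‖∑ j, h j • P.g j x‖ ^ 2 + ∑ j, (ψ j x * h j) ^ 2) := by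
    have : ∑ j, (‖v‖⁻¹ • v) j • P.g j x = ‖v‖⁻¹ • ∑ j, h j • P.g j x := by
      rw [Finset.smul_sum]
      exact Finset.sum_congr rfl fun j _ => by simp [hv, mul_smul]
    simp only [F, this]
    rw [norm_smul, mul_pow, mul_add, Finset.mul_sum, norm_inv, norm_norm]
    congr 1
    refine Finset.sum_congr rfl fun j _ => ?_
    simp [hv]
    ring
  rw [h2] at h1
  calc c * ‖v‖ ^ 2 ≤ ((‖v‖⁻¹) ^ 2 * (‖∑ j, h j • P.g j x‖ ^ 2 + ∑ j, (ψ j x * h j) ^ 2)) * ‖v‖ ^ 2 := by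
        gcongr
    _ = _ := by field_simp

end NLProblem

/-! ### The linear systems and uniform bounds along a run. -/

namespace NLProblem

variable {n m : ℕ} {P : NLProblem n m}

theorem SolvesSLE.stationary {x d0 d : EuclideanSpace ℝ (Fin n)} {B : Matrix (Fin n) (Fin n) ℝ}
    {r y : Fin m → ℝ} (h : P.SolvesSLE x B d0 r d y) :
    matVec B d + ∑ j, y j • P.g j x = 0 := by
  ext i
  have := congrFun h (Sum.inl i)
  simp only [coeffV, Matrix.fromBlocks_mulVec, Sum.elim_inl] at this
  simp only [matVec, PiLp.add_apply, PiLp.zero_apply, WithLp.ofLp_sum, Finset.sum_apply,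
    PiLp.smul_apply, smul_eq_mul]
  rw [← this]
  simp [Matrix.mulVec, dotProduct, gradMatrix, Function.comp_def, mul_comm, Matrix.toLpLin_apply]

theorem SolvesSLE.linearized {x d0 d : EuclideanSpace ℝ (Fin n)} {B : Matrix (Fin n) (Fin n) ℝ}
    {r y : Fin m → ℝ} (h : P.SolvesSLE x B d0 r d y) (j : Fin m) :
    inner ℝ (P.g j x) d - P.diagD x d0 j * y j = r j := by
  have := congrFun h (Sum.inr j)
  simp only [coeffV, Matrix.fromBlocks_mulVec, Sum.elim_inr] at this
  rw [← this]
  simp [Matrix.mulVec, dotProduct, gradMatrix, Function.comp_def, PiLp.inner_apply, mul_comm,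
    Matrix.diagonal_apply, sub_eq_add_neg]

theorem diagD_nonneg (x d0 : EuclideanSpace ℝ (Fin n)) (j : Fin m) : 0 ≤ P.diagD x d0 j := by
  unfold diagD; positivity

/-- This is where the form of `D` matters: `|fbar|` is at most `G` times the second factor of `D`,
so `D` dominates the weights of the Gram bound even when `d0` is small. -/
theorem sq_fbar_le_mul_diagD {x d0 : EuclideanSpace ℝ (Fin n)} {j : Fin m} {G : ℝ} (hG : 1 ≤ G)
    (hg : ‖P.g j x‖ ≤ G) : P.fbar j x ^ 2 ≤ G * P.diagD x d0 j := by
  have h1 : |inner ℝ (P.g j x) d0| ≤ G * ‖d0‖ :=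
    (abs_real_inner_le_norm _ _).trans (mul_le_mul_of_nonneg_right hg (norm_nonneg _))
  have h2 : |P.fbar j x| ≤ |P.fbar j x + inner ℝ (P.g j x) d0| + |inner ℝ (P.g j x) d0| := by
    have := abs_sub (P.fbar j x + inner ℝ (P.g j x) d0) (inner ℝ (P.g j x) d0)
    simpa using this
  have h3 : |P.fbar j x| ≤ G * (|P.fbar j x + inner ℝ (P.g j x) d0| + ‖d0‖) := by
    nlinarith [abs_nonneg (P.fbar j x + inner ℝ (P.g j x) d0)]
  unfold diagD
  rw [← sq_abs]
  nlinarith [abs_nonneg (P.fbar j x)]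

/-- The linear systems are uniformly solvable when the data are uniformly nondegenerate. -/
theorem exists_sle_bound (m : ℕ) {a b c G : ℝ} (ha : 0 < a) (hc : 0 < c)
    (hG : 1 ≤ G) :
    ∃ C, 0 ≤ C ∧ ∀ {n : ℕ} (P : NLProblem n m) {x d0 d : EuclideanSpace ℝ (Fin n)}
      {B : Matrix (Fin n) (Fin n) ℝ} {r y : Fin m → ℝ} {s : ℝ},
      (∀ d, a * ‖d‖ ^ 2 ≤ inner ℝ d (matVec B d)) → (∀ d, ‖matVec B d‖ ≤ b * ‖d‖) →
      (∀ j, ‖P.g j x‖ ≤ G) →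
      (∀ h : Fin m → ℝ,
        c * ∑ j, h j ^ 2 ≤ ‖∑ j, h j • P.g j x‖ ^ 2 + ∑ j, (P.fbar j x * h j) ^ 2) →
      P.SolvesSLE x B d0 r d y → 0 ≤ s → (∀ j, |r j| ≤ s) →
      ‖d‖ ≤ C * s ∧ ∀ j, |y j| ≤ C * s := by
  set K := b ^ 2 / a + G with hK
  have hKp : 0 < K := by positivity
  refine ⟨max (K * m / c) (√(K * m ^ 2 / (c * a))), by positivity, ?_⟩
  intro n P x d0 d B r y s hcoer hBn hg hgram hsol hs hr
  set N := √(∑ j, y j ^ 2) with hN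
  have hN0 : 0 ≤ N := Real.sqrt_nonneg _
  have hNsq : N ^ 2 = ∑ j, y j ^ 2 := Real.sq_sqrt (Finset.sum_nonneg fun j _ => sq_nonneg _)
  have hyN : ∀ j, |y j| ≤ N := fun j => Real.abs_le_sqrt
    (Finset.single_le_sum (f := fun j => y j ^ 2) (fun j _ => sq_nonneg _) (Finset.mem_univ j))
  have hst := hsol.stationary
  have hlin := hsol.linearized
  set Q := ∑ j, P.diagD x d0 j * y j ^ 2 with hQ
  have hQ0 : 0 ≤ Q := Finset.sum_nonneg fun j _ => mul_nonneg (diagD_nonneg _ _ _) (sq_nonneg _)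
  -- The first block row is paired with `d` and the second with `y`; the coupling terms cancel and
  -- leave two nonnegative energies.
  have henergy : inner ℝ d (matVec B d) + Q = -∑ j, y j * r j := by
    have h1 : inner ℝ d (matVec B d + ∑ j, y j • P.g j x) = 0 := by rw [hst, inner_zero_right]
    rw [inner_add_right, inner_sum] at h1
    have h2 : ∑ j, inner ℝ d (y j • P.g j x) = Q + ∑ j, y j * r j := by
      rw [hQ, ← Finset.sum_add_distrib]
      refine Finset.sum_congr rfl fun j _ => ?_
      rw [inner_smul_right, real_inner_comm, ← hlin j]
      ring
    linarith
  have hrhs : -∑ j, y j * r j ≤ m * (N * s) := by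
    rw [← Finset.sum_neg_distrib]
    calc ∑ j, -(y j * r j) ≤ ∑ _j : Fin m, N * s := by
          refine Finset.sum_le_sum fun j _ => ?_
          calc -(y j * r j) ≤ |y j * r j| := neg_le_abs _
            _ = |y j| * |r j| := abs_mul _ _
            _ ≤ N * s := mul_le_mul (hyN j) (hr j) (abs_nonneg _) hN0
      _ = m * (N * s) := by simp
  have hE : a * ‖d‖ ^ 2 + Q ≤ m * (N * s) := by linarith [hcoer d]
  have hd2 : ‖d‖ ^ 2 ≤ (m * (N * s)) / a := by
    rw [le_div_iff₀ ha]; linarith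
  -- The Gram bound is read with `∑ y_j g_j = -B d` and `fbar² ≤ G D`, so the energy controls `N²`.
  -- As the energy is itself at most `m N s`, one factor `N` cancels.
  have hNg : c * N ^ 2 ≤ K * (m * (N * s)) := by
    have h1 := hgram y
    have h2 : ∑ j, y j • P.g j x = -matVec B d := by
      rw [eq_neg_iff_add_eq_zero, add_comm]; exact hst
    have h3 : ‖∑ j, y j • P.g j x‖ ^ 2 ≤ b ^ 2 * ‖d‖ ^ 2 := by
      rw [h2, norm_neg, ← mul_pow]
      exact pow_le_pow_left₀ (norm_nonneg _) (hBn d) 2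
    have h4 : ∑ j, (P.fbar j x * y j) ^ 2 ≤ G * Q := by
      rw [hQ, Finset.mul_sum]
      refine Finset.sum_le_sum fun j _ => ?_
      rw [mul_pow, ← mul_assoc]
      exact mul_le_mul_of_nonneg_right (sq_fbar_le_mul_diagD hG (hg j)) (sq_nonneg _)
    have h5 : b ^ 2 * ‖d‖ ^ 2 ≤ b ^ 2 / a * (m * (N * s)) := by
      calc b ^ 2 * ‖d‖ ^ 2 ≤ b ^ 2 * ((m * (N * s)) / a) := by gcongr
        _ = _ := by ring
    have h6 : G * Q ≤ G * (m * (N * s)) := by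
      have : Q ≤ m * (N * s) := by nlinarith [sq_nonneg ‖d‖]
      gcongr
    rw [hNsq, hK]
    linarith
  have hNb : N ≤ K * m / c * s := by
    rcases hN0.eq_or_lt with h0 | h0
    · rw [← h0]; positivity
    · have : N * (c * N) ≤ N * (K * m * s) := by nlinarith
      have := le_of_mul_le_mul_left this h0
      rw [div_mul_eq_mul_div, le_div_iff₀ hc]
      linarith
  refine ⟨?_, fun j => (hyN j).trans (hNb.trans (mul_le_mul_of_nonneg_right (le_max_left _ _) hs))⟩
  refine le_trans ?_ (mul_le_mul_of_nonneg_right (le_max_right _ _) hs)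
  refine abs_le_of_sq_le_sq' ?_ (by positivity) |>.2
  rw [mul_pow, Real.sq_sqrt (by positivity)]
  calc ‖d‖ ^ 2 ≤ (m * (N * s)) / a := hd2
    _ ≤ (m * ((K * m / c * s) * s)) / a := by gcongr
    _ = _ := by field_simp

/-- Bounds that hold uniformly along a run. -/
structure Run.Bounded {A : AlgParams} (R : P.Run A) (a M : ℝ) : Prop where
  a_pos : 0 < a
  one_le : 1 ≤ M
  coercive : ∀ k d, a * ‖d‖ ^ 2 ≤ inner ℝ d (matVec (R.B k) d)
  norm_matVec : ∀ k d, ‖matVec (R.B k) d‖ ≤ M * ‖d‖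
  norm_x : ∀ k, ‖R.x k‖ ≤ M
  norm_g0 : ∀ k, ‖P.g0 (R.x k)‖ ≤ M
  norm_g : ∀ k j, ‖P.g j (R.x k)‖ ≤ M
  norm_d0 : ∀ k, ‖R.d0 k‖ ≤ M
  phi_le : ∀ k, P.phi (R.x k) ≤ M
  abs_fbar_le : ∀ k j, |P.fbar j (R.x k)| ≤ M
  abs_obj_le : ∀ k, |P.obj (R.x k)| ≤ M
  sle : ∀ k {r d y s}, P.SolvesSLE (R.x k) (R.B k) (R.d0 k) r d y → 0 ≤ s → (∀ j, |r j| ≤ s) →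
    ‖d‖ ≤ M * s ∧ ∀ j, |y j| ≤ M * s

/-- Complementarity gives `λ_j g_jᵀd = -λ_j fbar_j`, which is nonnegative because `fbar ≤ 0`. Hence
`g₀ᵀd0 ≤ 0` even at infeasible points. -/
theorem IsQPMultiplier.inner_g0_le {x d : EuclideanSpace ℝ (Fin n)}
    {B : Matrix (Fin n) (Fin n) ℝ} {lam : Fin m → ℝ} (h : P.IsQPMultiplier x B d lam) :
    inner ℝ (P.g0 x) d ≤ -inner ℝ d (matVec B d) := by
  have h1 : inner ℝ d (P.g0 x + matVec B d + ∑ j, lam j • P.g j x) = 0 := by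
    rw [h.stationary, inner_zero_right]
  rw [inner_add_right, inner_add_right, inner_sum] at h1
  have h2 : 0 ≤ ∑ j, inner ℝ d (lam j • P.g j x) := by
    refine Finset.sum_nonneg fun j _ => ?_
    rw [inner_smul_right, real_inner_comm]
    have := h.complementary j
    nlinarith [mul_nonneg (h.nonneg j) (neg_nonneg.2 (fbar_nonpos (P := P) j x))]
  rw [real_inner_comm]
  linarith

theorem continuous_g0 (hobj : ContDiff ℝ 2 P.obj) : Continuous P.g0 :=
  (contDiff_gradient hobj).continuous

theorem continuous_g (hcon : ∀ j, ContDiff ℝ 2 (P.con j)) (j : Fin m) : Continuous (P.g j) :=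
  (contDiff_gradient (hcon j)).continuous

theorem Run.exists_bounded {A : AlgParams} (R : P.Run A) (hindep : P.GradientsIndependent)
    {a b : ℝ} (ha : 0 < a)
    (hB : ∀ (k : ℕ) (d : EuclideanSpace ℝ (Fin n)),
      a * ‖d‖ ^ 2 ≤ inner ℝ d (matVec (R.B k) d) ∧
      inner ℝ d (matVec (R.B k) d) ≤ b * ‖d‖ ^ 2)
    (hobj : ContDiff ℝ 2 P.obj) (hcon : ∀ j, ContDiff ℝ 2 (P.con j))
    (hbdd : Bornology.IsBounded (Set.range R.x)) :
    ∃ M, R.Bounded a M := by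
  have hfc : ∀ j, Continuous (P.con j) := fun j => (hcon j).continuous
  obtain ⟨X, hX⟩ := hbdd.exists_norm_le
  have hX : ∀ k, ‖R.x k‖ ≤ X := fun k => hX _ ⟨k, rfl⟩
  have hS : IsCompact (Metric.closedBall (0 : EuclideanSpace ℝ (Fin n)) X) :=
    isCompact_closedBall _ _
  have hxS : ∀ k, R.x k ∈ Metric.closedBall (0 : EuclideanSpace ℝ (Fin n)) X :=
    fun k => by simpa using hX k
  obtain ⟨G0, hG0⟩ := hS.exists_bound_of_continuousOn (continuous_g0 hobj).continuousOn
  obtain ⟨F0, hF0⟩ := hS.exists_bound_of_continuousOn hobj.continuous.continuousOn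
  obtain ⟨Φ, hΦ⟩ := hS.exists_bound_of_continuousOn (continuous_phi hfc).continuousOn
  choose G1 hG1 using fun j => hS.exists_bound_of_continuousOn (continuous_g hcon j).continuousOn
  choose F1 hF1 using fun j => hS.exists_bound_of_continuousOn (hfc j).continuousOn
  obtain ⟨c, hc, hgram⟩ := exists_gram_lower_bound (continuous_g hcon) hfc hindep hS
  obtain ⟨G, hG⟩ := (Set.finite_range G1).bddAbove
  obtain ⟨F, hF⟩ := (Set.finite_range F1).bddAbove
  obtain ⟨C, hC0, hC⟩ := exists_sle_bound m (b := b) ha hc (le_max_left 1 G)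
  have hgb : ∀ k j, ‖P.g j (R.x k)‖ ≤ G := fun k j => (hG1 j _ (hxS k)).trans (hG ⟨j, rfl⟩)
  have hBn : ∀ k d, ‖matVec (R.B k) d‖ ≤ b * ‖d‖ := fun k =>
    norm_matVec_le (R.posDef k).1 (fun d => le_trans (by positivity) (hB k d).1)
      fun d => (hB k d).2
  -- From `a ‖d0‖² ≤ d0ᵀB d0 ≤ -g₀ᵀd0 ≤ G0 ‖d0‖`.
  have hd0 : ∀ k, ‖R.d0 k‖ ≤ G0 / a := by
    intro k
    have h1 := (R.step1_multiplier k).inner_g0_le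
    have h2 := (hB k (R.d0 k)).1
    have h3 := (neg_le_abs _).trans (abs_real_inner_le_norm (P.g0 (R.x k)) (R.d0 k))
    have h4 := hG0 _ (hxS k)
    rcases (norm_nonneg (R.d0 k)).eq_or_lt with h | h
    · rw [← h]
      have : 0 ≤ G0 := (norm_nonneg _).trans h4
      positivity
    · rw [le_div_iff₀ ha]
      have : ‖R.d0 k‖ * (‖R.d0 k‖ * a) ≤ ‖R.d0 k‖ * G0 := by nlinarith
      exact le_of_mul_le_mul_left this h
  have hΦ' : ∀ k, P.phi (R.x k) ≤ Φ := fun k => (le_abs_self _).trans (hΦ _ (hxS k))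
  have hfb : ∀ k j, |P.fbar j (R.x k)| ≤ F + Φ := by
    intro k j
    have h1 := abs_fbar_sub_con_le (P := P) j (R.x k)
    have h2 : |P.con j (R.x k)| ≤ F := (hF1 j _ (hxS k)).trans (hF ⟨j, rfl⟩)
    have h3 := abs_add_le (P.fbar j (R.x k) - P.con j (R.x k)) (P.con j (R.x k))
    rw [sub_add_cancel] at h3
    linarith [hΦ' k]
  obtain ⟨M, hM⟩ : ∃ M, ∀ z ∈ [1, b, X, G0, G, G0 / a, Φ, F + Φ, F0, C], z ≤ M := by
    have := (List.finite_toSet [1, b, X, G0, G, G0 / a, Φ, F + Φ, F0, C]).bddAbove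
    exact this
  simp only [List.mem_cons, List.not_mem_nil, or_false, forall_eq_or_imp, forall_eq] at hM
  obtain ⟨h1, hbM, hXM, hG0M, hGM, hdM, hΦM, hFM, hF0M, hCM⟩ := hM
  refine ⟨M,
    { a_pos := ha
      one_le := h1
      coercive := fun k d => (hB k d).1
      norm_matVec := fun k d => (hBn k d).trans (by gcongr)
      norm_x := fun k => (hX k).trans hXM
      norm_g0 := fun k => (hG0 _ (hxS k)).trans hG0M
      norm_g := fun k j => (hgb k j).trans hGM
      norm_d0 := fun k => (hd0 k).trans hdM
      phi_le := fun k => (hΦ' k).trans hΦM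
      abs_fbar_le := fun k j => (hfb k j).trans hFM
      abs_obj_le := fun k => (hF0 _ (hxS k)).trans hF0M
      sle := by
        intro k r d y s hsol hs hr
        obtain ⟨h1, h2⟩ := hC P (fun d => (hB k d).1) (hBn k)
          (fun j => (hgb k j).trans (le_max_right _ _)) (hgram _ (hxS k)) hsol hs hr
        have : C * s ≤ M * s := by gcongr
        exact ⟨h1.trans this, fun j => (h2 j).trans this⟩ }⟩

/-- Quadratic Taylor bounds on a ball, simultaneously for the objective and the constraints. -/
theorem exists_uniform_taylor_bound (hobj : ContDiff ℝ 2 P.obj)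
    (hcon : ∀ j, ContDiff ℝ 2 (P.con j)) (r : ℝ) :
    ∃ C, 0 ≤ C ∧ ∀ x d : EuclideanSpace ℝ (Fin n), ‖x‖ ≤ r → ‖x + d‖ ≤ r →
      |P.obj (x + d) - P.obj x - inner ℝ (P.g0 x) d| ≤ C * ‖d‖ ^ 2 ∧
      ∀ j, ‖P.g j (x + d) - P.g j x‖ ≤ C * ‖d‖ ∧
        |P.con j (x + d) - P.con j x - inner ℝ (P.g j x) d| ≤ C * ‖d‖ ^ 2 := by
  obtain ⟨C0, hC0, h0⟩ := exists_taylor_bound hobj r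
  choose C1 hC1 h1 using fun j => exists_taylor_bound (hcon j) r
  obtain ⟨C, hC⟩ := (Set.finite_range C1).bddAbove
  have hC : ∀ j, C1 j ≤ max C0 C := fun j => (hC ⟨j, rfl⟩).trans (le_max_right _ _)
  refine ⟨max C0 C, le_max_of_le_left hC0, fun x d hx hd => ⟨?_, fun j => ⟨?_, ?_⟩⟩⟩
  · exact (h0 x d hx hd).2.trans (by gcongr; exact le_max_left _ _)
  · exact (h1 j x d hx hd).1.trans (by gcongr; exact hC j)
  · exact (h1 j x d hx hd).2.trans (by gcongr; exact hC j)

end NLProblem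

/-! ### A merit function argument for real sequences. -/

/-- If `u` decreases by `c t e` up to `C t p ^ θ`, and `p` decreases by `c t p ^ σ` down to zero at
most, then `t (e + p ^ θ)` tends to zero when `θ < σ`. -/
theorem tendsto_mul_add_rpow_of_decrease {u p t e : ℕ → ℝ} {c C θ σ M : ℝ} (hc : 0 < c)
    (hC : 0 ≤ C) (hθ : 0 < θ) (hθσ : θ < σ) (hσ : σ < 1) (ht : ∀ k, 0 ≤ t k)
    (he : ∀ k, 0 ≤ e k) (hp : ∀ k, 0 ≤ p k) (hu : ∀ k, -M ≤ u k)
    (hu' : ∀ k, u (k + 1) ≤ u k - c * t k * e k + C * t k * p k ^ θ)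
    (hp' : ∀ k, p (k + 1) ≤ max 0 (p k - c * t k * p k ^ σ)) :
    Tendsto (fun k => t k * (e k + p k ^ θ)) atTop (𝓝 0) := by
  have hanti : Antitone p := by
    refine antitone_nat_of_succ_le fun k => (hp' k).trans (max_le (hp k) ?_)
    have : 0 ≤ c * t k * p k ^ σ :=
      mul_nonneg (mul_nonneg hc.le (ht k)) (Real.rpow_nonneg (hp k) _)
    linarith
  -- The estimate below may fail when `p` jumps from a positive value to zero. By monotonicity this
  -- happens at most once, and the tail from `N` on avoids it.
  obtain ⟨N, hN⟩ : ∃ N, ∀ k, N ≤ k → 0 < p (k + 1) ∨ p k = 0 := by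
    by_cases h : ∃ N, p N = 0
    · obtain ⟨N, hN⟩ := h
      exact ⟨N, fun k hk => Or.inr (le_antisymm ((hanti hk).trans hN.le) (hp k))⟩
    · push Not at h
      exact ⟨0, fun k _ => Or.inl ((hp _).lt_of_ne' (h _))⟩
  -- With this exponent in `(0, 1)`, a decrease of `p` by `c t p^σ` lowers `p^π` by at least `π c t
  -- p^θ`.
  set π := 1 + θ - σ with hπ
  have hπ0 : 0 < π := by linarith
  -- Chosen so that the decrease of `K p^π` absorbs `C t p^θ` and leaves `c t p^θ` over.
  set K := (C + c) / (c * π) with hK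
  have hK0 : 0 ≤ K := by positivity
  set v : ℕ → ℝ := fun k => u (k + N) + K * p (k + N) ^ π with hv
  have hdec : ∀ k, v (k + 1) ≤ v k - c * (t (k + N) * (e (k + N) + p (k + N) ^ θ)) := by
    intro k
    have hstep : K * p (k + N + 1) ^ π ≤
        K * p (k + N) ^ π - (C + c) * t (k + N) * p (k + N) ^ θ := by
      generalize hi : k + N = i
      rcases hN i (by omega) with hpos | hzero
      · have hpi : 0 < p i := hpos.trans_le (hanti i.le_succ)
        have h1 : p (i + 1) ≤ p i - c * t i * p i ^ σ := by
          rcases le_max_iff.1 (hp' i) with h | h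
          · exact absurd hpos h.not_gt
          · exact h
        -- Bernoulli's inequality for exponents at most one, that is, concavity of the power.
        have h2 : (p (i + 1) / p i) ^ π ≤ 1 + π * (p (i + 1) / p i - 1) := by
          have := rpow_one_add_le_one_add_mul_self (s := p (i + 1) / p i - 1)
            (by linarith [div_nonneg hpos.le hpi.le]) hπ0.le (by linarith : π ≤ 1)
          simpa using this
        rw [Real.div_rpow hpos.le hpi.le, div_le_iff₀ (Real.rpow_pos_of_pos hpi _)] at h2
        have h3 : p i ^ π = p i ^ (θ - σ) * p i := by
          rw [← Real.rpow_add_one hpi.ne']; congr 1; rw [hπ]; ring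
        have h4 : p i ^ (θ - σ) * p i ^ σ = p i ^ θ := by
          rw [← Real.rpow_add hpi]; congr 1; ring
        have h5 : (1 + π * (p (i + 1) / p i - 1)) * p i ^ π =
            p i ^ π - π * (p i ^ (θ - σ) * (p i - p (i + 1))) := by
          rw [h3]; field_simp; ring
        have h6 : c * t i * p i ^ θ ≤ p i ^ (θ - σ) * (p i - p (i + 1)) := by
          rw [← h4]
          have := mul_le_mul_of_nonneg_left (show c * t i * p i ^ σ ≤ p i - p (i + 1) by linarith)
            (Real.rpow_nonneg hpi.le (θ - σ))
          linarith
        have h7 : p (i + 1) ^ π ≤ p i ^ π - π * (c * t i * p i ^ θ) := by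
          rw [h5] at h2
          linarith [mul_le_mul_of_nonneg_left h6 hπ0.le]
        calc K * p (i + 1) ^ π ≤ K * (p i ^ π - π * (c * t i * p i ^ θ)) := by gcongr
          _ = _ := by rw [hK]; field_simp
      · have h1 : p (i + 1) = 0 := le_antisymm ((hanti i.le_succ).trans hzero.le) (hp _)
        rw [h1, hzero, Real.zero_rpow hπ0.ne', Real.zero_rpow hθ.ne']
        simp
    have h1 := hu' (k + N)
    have h2 : v (k + 1) = u (k + N + 1) + K * p (k + N + 1) ^ π := by
      simp only [hv, show k + 1 + N = k + N + 1 by ring]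
    rw [h2]
    simp only [hv]
    linarith
  have hterm : ∀ k, 0 ≤ t k * (e k + p k ^ θ) := fun k =>
    mul_nonneg (ht k) (add_nonneg (he k) (Real.rpow_nonneg (hp k) _))
  have hvanti : Antitone v := antitone_nat_of_succ_le fun k =>
    (hdec k).trans (by linarith [mul_nonneg hc.le (hterm (k + N))])
  have hvbdd : BddBelow (Set.range v) := by
    refine ⟨-M, ?_⟩
    rintro _ ⟨k, rfl⟩
    have : 0 ≤ K * p (k + N) ^ π := mul_nonneg hK0 (Real.rpow_nonneg (hp _) _)
    simp only [hv]
    linarith [hu (k + N)]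
  have hlim := tendsto_atTop_ciInf hvanti hvbdd
  have hdiff : Tendsto (fun k => c⁻¹ * (v k - v (k + 1))) atTop (𝓝 0) := by
    have := (hlim.sub ((tendsto_add_atTop_iff_nat 1).2 hlim)).const_mul c⁻¹
    simpa using this
  rw [← tendsto_add_atTop_iff_nat N]
  refine squeeze_zero (fun k => hterm _) (fun k => ?_) hdiff
  rw [le_inv_mul_iff₀ hc]
  linarith [hdec k]

/-! ### Sufficient decrease common to both kinds of iteration. -/

namespace NLProblem

variable {n m : ℕ} {P : NLProblem n m} {A : AlgParams} {R : P.Run A} {a M : ℝ}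

theorem Iteration.trace_or_steps45 {x d0 d1 q : EuclideanSpace ℝ (Fin n)}
    {B : Matrix (Fin n) (Fin n) ℝ} {tr : List ℕ} {t : ℝ}
    (h : P.Iteration A x B d0 d1 tr t q) :
    (tr = [1, 2, 3, 6] ∧ q = d0 + d1 ∧ P.Step3Succeeds A x d0 (d0 + d1) t) ∨
    (P.Steps45 A x B d0 q t ∧
      (¬ P.Step2Test A x d0 (d0 + d1) ∨ P.Step3Fails A x d0 (d0 + d1))) := by
  cases h with
  | cycleI test success => exact Or.inl ⟨rfl, rfl, success⟩
  | step3Failed test failure steps45 => exact Or.inr ⟨steps45, Or.inr failure⟩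
  | testFailed test steps45 => exact Or.inr ⟨steps45, Or.inl test⟩

theorem rpow_phi_nonneg (x : EuclideanSpace ℝ (Fin n)) (s : ℝ) : 0 ≤ P.phi x ^ s :=
  Real.rpow_nonneg (phi_nonneg x) s

theorem phi_le_max {x y : EuclideanSpace ℝ (Fin n)} {δ : ℝ}
    (hv : ∀ j, 0 < P.con j x → P.con j y ≤ P.phi x - δ)
    (hs : ∀ j, P.con j x ≤ 0 → P.con j y ≤ 0) : P.phi y ≤ max 0 (P.phi x - δ) := by
  refine phi_le_iff.2 ⟨le_max_left _ _, fun j => ?_⟩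
  rcases le_or_gt (P.con j x) 0 with h | h
  · exact (hs j h).trans (le_max_left _ _)
  · exact (hv j h).trans (le_max_right _ _)

namespace Run.Bounded

theorem pos (h : R.Bounded a M) : 0 < M := zero_lt_one.trans_le h.one_le

theorem inner_g0_le (h : R.Bounded a M) (k : ℕ) :
    inner ℝ (P.g0 (R.x k)) (R.d0 k) ≤ -(a * ‖R.d0 k‖ ^ 2) :=
  (R.step1_multiplier k).inner_g0_le.trans (neg_le_neg (h.coercive k _))

theorem rpow_phi_le (h : R.Bounded a M) (k : ℕ) :
    P.phi (R.x k) ^ A.sigma ≤ M := by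
  calc P.phi (R.x k) ^ A.sigma ≤ M ^ A.sigma :=
        Real.rpow_le_rpow (phi_nonneg _) (h.phi_le k) (A.theta_pos.trans A.theta_lt_sigma).le
    _ ≤ M ^ (1 : ℝ) := Real.rpow_le_rpow_of_exponent_le h.one_le A.sigma_lt_one.le
    _ = M := Real.rpow_one M

theorem rpow_sigma_le (h : R.Bounded a M) (k : ℕ) :
    P.phi (R.x k) ^ A.sigma ≤ M * P.phi (R.x k) ^ A.theta := by
  have hts := A.theta_lt_sigma
  have hs := A.sigma_lt_one
  have ht := A.theta_pos
  have h1 : P.phi (R.x k) ^ A.sigma =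
      P.phi (R.x k) ^ (A.sigma - A.theta) * P.phi (R.x k) ^ A.theta := by
    rw [← Real.rpow_add_of_nonneg (phi_nonneg _) (by linarith) ht.le]
    congr 1; ring
  rw [h1]
  refine mul_le_mul_of_nonneg_right ?_ (rpow_phi_nonneg _ _)
  calc P.phi (R.x k) ^ (A.sigma - A.theta) ≤ M ^ (A.sigma - A.theta) :=
        Real.rpow_le_rpow (phi_nonneg _) (h.phi_le k) (by linarith)
    _ ≤ M ^ (1 : ℝ) := Real.rpow_le_rpow_of_exponent_le h.one_le (by linarith)
    _ = M := Real.rpow_one M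

theorem tilde_bound (h : R.Bounded a M) {k : ℕ} {dt : EuclideanSpace ℝ (Fin n)} {y : Fin m → ℝ}
    (hs : P.SolvesSLE (R.x k) (R.B k) (R.d0 k) (P.rhsTilde A (R.x k) (R.d0 k)) dt y) :
    ‖dt‖ ≤ M * (‖R.d0 k‖ + P.phi (R.x k) ^ A.sigma) ∧
      ∀ j, |y j| ≤ M * (‖R.d0 k‖ + P.phi (R.x k) ^ A.sigma) := by
  have hw : 0 ≤ ‖R.d0 k‖ + P.phi (R.x k) ^ A.sigma :=
    add_nonneg (norm_nonneg _) (rpow_phi_nonneg _ _)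
  refine h.sle k hs hw fun j => ?_
  rw [rhsTilde, abs_neg, abs_of_nonneg hw]

end Run.Bounded

theorem beta_nonneg_le_one {x d0 dt : EuclideanSpace ℝ (Fin n)}
    (hd : inner ℝ (P.g0 x) d0 ≤ 0) : 0 ≤ P.beta A x d0 dt ∧ P.beta A x d0 dt ≤ 1 := by
  unfold beta
  split_ifs with hlt
  · refine ⟨le_min zero_le_one (div_nonneg ?_ (by linarith)), min_le_left _ _⟩
    have := A.theta_lt_sigma.trans A.sigma_lt_one
    nlinarith [rpow_phi_nonneg (P := P) x A.theta]
  · exact ⟨zero_le_one, le_rfl⟩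

/-- When `d̃` is worse than `d0` for the objective, `β` is the largest weight in `[0, 1]` with this
property. Otherwise `β = 1`, and `g₀ᵀd0 ≤ θ g₀ᵀd0` suffices. -/
theorem inner_g0_combination_le {x d0 dt : EuclideanSpace ℝ (Fin n)}
    (hd : inner ℝ (P.g0 x) d0 ≤ 0) :
    inner ℝ (P.g0 x) ((1 - P.beta A x d0 dt) • d0 + P.beta A x d0 dt • dt) ≤
      A.theta * inner ℝ (P.g0 x) d0 + P.phi x ^ A.theta := by
  have hθ := A.theta_lt_sigma.trans A.sigma_lt_one
  have hφ := rpow_phi_nonneg (P := P) x A.theta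
  rw [inner_add_right, inner_smul_right, inner_smul_right]
  unfold beta
  split_ifs with hlt
  · have h1 := min_le_right 1 (((A.theta - 1) * inner ℝ (P.g0 x) d0 + P.phi x ^ A.theta) /
      (inner ℝ (P.g0 x) dt - inner ℝ (P.g0 x) d0))
    rw [le_div_iff₀ (by linarith)] at h1
    linarith
  · nlinarith

namespace Run.Bounded

/-- If `β` is the quotient, its denominator is at most `2 M² w` with `w = ‖d0‖ + φ^σ`, so the factor
`w` in `β w` cancels and the numerator remains. -/
theorem min_le_beta_mul (h : R.Bounded a M) {k : ℕ} {dt : EuclideanSpace ℝ (Fin n)}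
    {y : Fin m → ℝ}
    (hs : P.SolvesSLE (R.x k) (R.B k) (R.d0 k) (P.rhsTilde A (R.x k) (R.d0 k)) dt y) :
    min (‖R.d0 k‖ + P.phi (R.x k) ^ A.sigma)
      (((1 - A.theta) * a * ‖R.d0 k‖ ^ 2 + P.phi (R.x k) ^ A.theta) / (2 * M ^ 2)) ≤
    P.beta A (R.x k) (R.d0 k) dt * (‖R.d0 k‖ + P.phi (R.x k) ^ A.sigma) := by
  have hθ := A.theta_lt_sigma.trans A.sigma_lt_one
  have hdt := (h.tilde_bound hs).1
  have hdesc := h.inner_g0_le k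
  have hM := h.one_le
  have hσ0 := rpow_phi_nonneg (P := P) (R.x k) A.sigma
  have hθ0 := rpow_phi_nonneg (P := P) (R.x k) A.theta
  have ha := h.a_pos
  set w := ‖R.d0 k‖ + P.phi (R.x k) ^ A.sigma with hw
  have hw0 : 0 ≤ w := add_nonneg (norm_nonneg _) hσ0
  have hdw : ‖R.d0 k‖ ≤ w := by linarith
  unfold beta
  split_ifs with hlt
  · set Δ := inner ℝ (P.g0 (R.x k)) dt - inner ℝ (P.g0 (R.x k)) (R.d0 k) with hΔ
    have hΔ0 : 0 < Δ := by linarith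
    set num := (A.theta - 1) * inner ℝ (P.g0 (R.x k)) (R.d0 k) + P.phi (R.x k) ^ A.theta
      with hnum
    have hnum' : (1 - A.theta) * a * ‖R.d0 k‖ ^ 2 + P.phi (R.x k) ^ A.theta ≤ num := by
      have := mul_le_mul_of_nonneg_left hdesc (by linarith : 0 ≤ 1 - A.theta)
      linarith
    have hnum0 : 0 ≤ (1 - A.theta) * a * ‖R.d0 k‖ ^ 2 + P.phi (R.x k) ^ A.theta :=
      add_nonneg (mul_nonneg (mul_nonneg (by linarith) ha.le) (sq_nonneg _)) hθ0
    have hΔw : Δ ≤ 2 * M ^ 2 * w := by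
      have h1 := (le_abs_self _).trans (abs_real_inner_le_norm (P.g0 (R.x k)) dt)
      have h2 := (neg_le_abs _).trans (abs_real_inner_le_norm (P.g0 (R.x k)) (R.d0 k))
      have h3 : ‖P.g0 (R.x k)‖ * ‖dt‖ ≤ M * (M * w) :=
        mul_le_mul (h.norm_g0 k) hdt (norm_nonneg _) h.pos.le
      have h4 : ‖P.g0 (R.x k)‖ * ‖R.d0 k‖ ≤ M * w :=
        mul_le_mul (h.norm_g0 k) hdw (norm_nonneg _) h.pos.le
      nlinarith [mul_nonneg h.pos.le hw0]
    rcases min_choice 1 (num / Δ) with h1 | h1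
    · rw [h1, one_mul]; exact min_le_left _ _
    · rw [h1]
      refine (min_le_right _ _).trans ?_
      rw [div_mul_eq_mul_div, div_le_div_iff₀ (by have := h.pos; positivity) hΔ0]
      calc ((1 - A.theta) * a * ‖R.d0 k‖ ^ 2 + P.phi (R.x k) ^ A.theta) * Δ ≤
          num * (2 * M ^ 2 * w) := mul_le_mul hnum' hΔw hΔ0.le (hnum0.trans hnum')
        _ = num * w * (2 * M ^ 2) := by ring
  · rw [one_mul]; exact min_le_left _ _

/-- Brings the decrease of `φ` in Step 5 to the form `t φ^σ` that Step 3 provides; it uses `φ^σ ≤ M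
φ^θ`. -/
theorem rpow_sigma_le_beta_mul (h : R.Bounded a M) {k : ℕ} {dt : EuclideanSpace ℝ (Fin n)}
    {y : Fin m → ℝ}
    (hs : P.SolvesSLE (R.x k) (R.B k) (R.d0 k) (P.rhsTilde A (R.x k) (R.d0 k)) dt y) :
    P.phi (R.x k) ^ A.sigma / (2 * M ^ 3) ≤
    P.beta A (R.x k) (R.d0 k) dt * (‖R.d0 k‖ + P.phi (R.x k) ^ A.sigma) := by
  refine le_trans ?_ (h.min_le_beta_mul hs)
  have hM := h.one_le
  have hM0 := h.pos
  have hσ0 := rpow_phi_nonneg (P := P) (R.x k) A.sigma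
  have hθ := A.theta_lt_sigma.trans A.sigma_lt_one
  have ha := h.a_pos
  refine le_min ?_ ?_
  · have h1 : P.phi (R.x k) ^ A.sigma / (2 * M ^ 3) ≤ P.phi (R.x k) ^ A.sigma :=
      div_le_self hσ0 (by nlinarith [one_le_pow₀ hM (n := 3)])
    linarith [norm_nonneg (R.d0 k)]
  · rw [div_le_div_iff₀ (by positivity) (by positivity)]
    have h1 := h.rpow_sigma_le k
    have h2 : 0 ≤ (1 - A.theta) * a * ‖R.d0 k‖ ^ 2 :=
      mul_nonneg (mul_nonneg (by linarith) ha.le) (sq_nonneg _)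
    calc P.phi (R.x k) ^ A.sigma * (2 * M ^ 2) ≤
        (M * ((1 - A.theta) * a * ‖R.d0 k‖ ^ 2 + P.phi (R.x k) ^ A.theta)) * (2 * M ^ 2) := by
          gcongr
          nlinarith
      _ = _ := by ring

theorem step_pos_le_one (R : P.Run A) (k : ℕ) : 0 < R.t k ∧ R.t k ≤ 1 := by
  rcases (R.iteration k).trace_or_steps45 with ⟨-, -, i, hi, -⟩ | ⟨⟨_, _, -, -, i, hi, -⟩, -⟩
  · rw [hi]; exact ⟨by positivity, pow_le_one₀ (by norm_num) (by norm_num)⟩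
  · rw [hi]; exact ⟨pow_pos A.eta_mem.1 _, pow_le_one₀ A.eta_mem.1.le A.eta_mem.2.le⟩

/-- The factor `ρ + 1` allows for Step 5, where the bound on `g₀ᵀq` adds `γ t φ^θ` to the term `ρ (1
- γ) t φ^θ` of the line search. -/
theorem exists_decrease (h : R.Bounded a M) : ∃ c > 0, ∀ k,
    P.obj (R.x (k + 1)) ≤ P.obj (R.x k) - c * R.t k * ‖R.d0 k‖ ^ 2
      + (A.rho + 1) * R.t k * P.phi (R.x k) ^ A.theta ∧
    P.phi (R.x (k + 1)) ≤ max 0 (P.phi (R.x k) - c * R.t k * P.phi (R.x k) ^ A.sigma) := by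
  have ha := h.a_pos
  have hM := h.pos
  have hα := A.alpha_mem.1
  have hα2 := A.alpha_mem.2
  have hγ := A.gamma_mem.1
  have hγ1 := A.gamma_mem.2
  have hθ := A.theta_pos
  have hρ := A.one_lt_rho
  obtain ⟨c, hc, hc1, hc2, hc3, hc4⟩ : ∃ c > 0, c ≤ A.alpha * a ∧ c ≤ A.gamma * A.theta * a ∧
      c ≤ A.alpha ∧ c ≤ A.gamma / (2 * M ^ 3) :=
    ⟨min (min (A.alpha * a) (A.gamma * A.theta * a)) (min A.alpha (A.gamma / (2 * M ^ 3))),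
      by positivity, (min_le_left _ _).trans (min_le_left _ _),
      (min_le_left _ _).trans (min_le_right _ _), (min_le_right _ _).trans (min_le_left _ _),
      (min_le_right _ _).trans (min_le_right _ _)⟩
  refine ⟨c, hc, fun k => ?_⟩
  obtain ⟨ht, -⟩ := step_pos_le_one R k
  have hdesc := h.inner_g0_le k
  have hσ0 := rpow_phi_nonneg (P := P) (R.x k) A.sigma
  have hθ0 := rpow_phi_nonneg (P := P) (R.x k) A.theta
  have hd2 := sq_nonneg ‖R.d0 k‖
  have htφ := mul_nonneg ht.le hθ0
  rw [R.step6_update k]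
  rcases (R.iteration k).trace_or_steps45 with ⟨-, hq, i, hi, -, hcond, -⟩ |
    ⟨⟨dt, y, hsol, hq, i, hi, hcond, -⟩, -⟩
  · rw [hq]
    constructor
    · have h1 := hcond.objective
      have h2 : A.alpha * R.t k * inner ℝ (P.g0 (R.x k)) (R.d0 k) ≤
          -(c * R.t k * ‖R.d0 k‖ ^ 2) := by
        have := mul_le_mul_of_nonneg_left hdesc (mul_nonneg hα.le ht.le)
        nlinarith [mul_le_mul_of_nonneg_right hc1 (mul_nonneg ht.le hd2)]
      have h3 : A.rho * (1 - A.alpha) * R.t k * P.phi (R.x k) ^ A.theta ≤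
          (A.rho + 1) * R.t k * P.phi (R.x k) ^ A.theta := by
        have := mul_le_mul_of_nonneg_right
          (show A.rho * (1 - A.alpha) ≤ A.rho + 1 by nlinarith) htφ
        linarith
      linarith
    · refine (phi_le_max hcond.violated hcond.satisfied).trans (max_le_max le_rfl ?_)
      have h1 : 0 ≤ ‖R.d0 k‖ ^ A.tau := Real.rpow_nonneg (norm_nonneg _) _
      have h2 := mul_le_mul_of_nonneg_right hc3 (mul_nonneg ht.le hσ0)
      have h3 := mul_nonneg (mul_nonneg hα.le ht.le) h1
      linarith
  · have hq' := inner_g0_combination_le (P := P) (A := A) (x := R.x k) (d0 := R.d0 k) (dt := dt)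
      (hdesc.trans (by nlinarith))
    rw [← hq] at hq'
    constructor
    · have h1 := hcond.objective
      have h2 : A.gamma * R.t k * inner ℝ (P.g0 (R.x k)) (R.dir k) ≤
          A.gamma * R.t k * (A.theta * -(a * ‖R.d0 k‖ ^ 2) + P.phi (R.x k) ^ A.theta) := by
        refine mul_le_mul_of_nonneg_left (hq'.trans ?_) (mul_nonneg hγ.le ht.le)
        linarith [mul_le_mul_of_nonneg_left hdesc hθ.le]
      have h3 := mul_le_mul_of_nonneg_right hc2 (mul_nonneg ht.le hd2)
      have h4 : A.gamma * R.t k * P.phi (R.x k) ^ A.theta +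
          A.rho * (1 - A.gamma) * R.t k * P.phi (R.x k) ^ A.theta ≤
          (A.rho + 1) * R.t k * P.phi (R.x k) ^ A.theta := by
        have := mul_le_mul_of_nonneg_right
          (show A.gamma + A.rho * (1 - A.gamma) ≤ A.rho + 1 by nlinarith) htφ
        linarith
      linarith
    · refine (phi_le_max hcond.violated hcond.satisfied).trans (max_le_max le_rfl ?_)
      have h1 := mul_le_mul_of_nonneg_left (h.rpow_sigma_le_beta_mul hsol)
        (mul_nonneg hγ.le ht.le)
      have h2 := mul_le_mul_of_nonneg_right hc4 (mul_nonneg ht.le hσ0)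
      have h3 : A.gamma / (2 * M ^ 3) * (R.t k * P.phi (R.x k) ^ A.sigma) =
        A.gamma * R.t k * (P.phi (R.x k) ^ A.sigma / (2 * M ^ 3)) := by ring
      linarith

theorem tendsto_step_mul (h : R.Bounded a M) :
    Tendsto (fun k => R.t k * (‖R.d0 k‖ ^ 2 + P.phi (R.x k) ^ A.theta)) atTop (𝓝 0) := by
  obtain ⟨c, hc, hdec⟩ := h.exists_decrease
  exact tendsto_mul_add_rpow_of_decrease (u := fun k => P.obj (R.x k))
    (p := fun k => P.phi (R.x k)) (M := M) hc (by linarith [A.one_lt_rho]) A.theta_pos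
    A.theta_lt_sigma A.sigma_lt_one (fun k => (step_pos_le_one R k).1.le) (fun k => sq_nonneg _)
    (fun k => phi_nonneg _) (fun k => (abs_le.1 (h.abs_obj_le k)).1) (fun k => (hdec k).1)
    fun k => (hdec k).2

end Run.Bounded
end NLProblem

/-! ### Steplengths bounded below; `d0`, `φ` and the increments tend to zero. -/

namespace NLProblem

variable {n m : ℕ} {P : NLProblem n m} {A : AlgParams} {R : P.Run A} {a M : ℝ}

namespace Run.Bounded

theorem diagD_le (h : R.Bounded a M) (k : ℕ) (j : Fin m) :
    P.diagD (R.x k) (R.d0 k) j ≤ |P.fbar j (R.x k)| * (3 * M ^ 2) := by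
  have hM := h.one_le
  have h1 : |P.fbar j (R.x k) + inner ℝ (P.g j (R.x k)) (R.d0 k)| ≤ M + M * M :=
    (abs_add_le _ _).trans (add_le_add (h.abs_fbar_le k j)
      ((abs_real_inner_le_norm _ _).trans
        (mul_le_mul (h.norm_g k j) (h.norm_d0 k) (norm_nonneg _) h.pos.le)))
  unfold diagD
  refine mul_le_mul_of_nonneg_left ?_ (abs_nonneg _)
  nlinarith [h.norm_d0 k]

/-- The arc search of Step 5 has steplengths bounded away from zero as long as the iterates are
not asymptotically stationary and feasible. -/
theorem exists_step5_threshold (h : R.Bounded a M) (hobj : ContDiff ℝ 2 P.obj)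
    (hcon : ∀ j, ContDiff ℝ 2 (P.con j)) {ν : ℝ} (hν : 0 < ν) :
    ∃ T > 0, ∀ k, ν ≤ ‖R.d0 k‖ ^ 2 + P.phi (R.x k) ^ A.theta →
      ∀ (dt : EuclideanSpace ℝ (Fin n)) (y : Fin m → ℝ),
        P.SolvesSLE (R.x k) (R.B k) (R.d0 k) (P.rhsTilde A (R.x k) (R.d0 k)) dt y →
        ∀ t, 0 < t → t ≤ 1 → t ≤ T →
          P.Step5Conditions A (R.x k) (R.d0 k)
            ((1 - P.beta A (R.x k) (R.d0 k) dt) • R.d0 k + P.beta A (R.x k) (R.d0 k) dt • dt)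
            (P.beta A (R.x k) (R.d0 k) dt) t := by
  have ha := h.a_pos
  have hM := h.pos
  have hM1 := h.one_le
  have hγ := A.gamma_mem.1
  have hγ1 := A.gamma_mem.2
  have hθ := A.theta_pos
  have hθ1 := A.theta_lt_sigma.trans A.sigma_lt_one
  have hρ := A.one_lt_rho
  set Q := M + 2 * M ^ 2 with hQ
  have hQ0 : 0 < Q := by positivity
  obtain ⟨C, hC0, hC⟩ := exists_uniform_taylor_bound hobj hcon (M + Q)
  -- `κ ν` bounds from below the first-order slack `ρ φ^θ - g₀ᵀq` of the objective condition.
  set κ := min (A.rho - 1) (A.theta * a) with hκ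
  have hκ0 : 0 < κ := lt_min (by linarith) (by positivity)
  -- Lower bound for `β w`. The inner minimum bounds `w`: one of `‖d0‖²` and `φ^θ` is at least `ν /
  -- 2`.
  set ω := min (min (ν / (2 * M)) ((ν / 2) ^ (A.sigma / A.theta)))
    (min ((1 - A.theta) * a) 1 * ν / (2 * M ^ 2)) with hω
  have hω0 : 0 < ω := by
    have : 0 < min ((1 - A.theta) * a) 1 := lt_min (mul_pos (by linarith) ha) one_pos
    exact lt_min (lt_min (by positivity) (by positivity)) (by positivity)
  set H := 3 * M ^ 2 * (2 * M ^ 2) with hH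
  have hH0 : 0 ≤ H := by positivity
  -- The first bound makes `t (1 + H) |fbar|` at most `|fbar|`; the other two absorb the Taylor
  -- remainder in the objective and in the constraints. The `+ 1` covers `C = 0`.
  refine ⟨min (1 / (1 + H)) (min ((1 - A.gamma) * (κ * ν) / (C * Q ^ 2 + 1))
    ((1 - A.gamma) * ω / (C * Q ^ 2 + 1))), ?_, ?_⟩
  · have : 0 < 1 - A.gamma := by linarith
    positivity
  intro k hk dt y hsol t ht ht1 htT
  have htH : t * (1 + H) ≤ 1 := by
    have := htT.trans (min_le_left _ _)
    rwa [le_div_iff₀ (by positivity)] at this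
  have htκ : t * (C * Q ^ 2 + 1) ≤ (1 - A.gamma) * (κ * ν) := by
    have := htT.trans ((min_le_right _ _).trans (min_le_left _ _))
    rwa [le_div_iff₀ (by positivity)] at this
  have htω : t * (C * Q ^ 2 + 1) ≤ (1 - A.gamma) * ω := by
    have := htT.trans ((min_le_right _ _).trans (min_le_right _ _))
    rwa [le_div_iff₀ (by positivity)] at this
  have hdesc := h.inner_g0_le k
  have hdesc0 : inner ℝ (P.g0 (R.x k)) (R.d0 k) ≤ 0 := hdesc.trans (by
    have : 0 ≤ a * ‖R.d0 k‖ ^ 2 := by positivity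
    linarith)
  obtain ⟨hβ0, hβ1⟩ := beta_nonneg_le_one (P := P) (A := A) (dt := dt) hdesc0
  have hq0 := inner_g0_combination_le (P := P) (A := A) (dt := dt) hdesc0
  have hβw := h.min_le_beta_mul hsol
  obtain ⟨hdt, hy⟩ := h.tilde_bound hsol
  have hlin := hsol.linearized
  have hσ0 := rpow_phi_nonneg (P := P) (R.x k) A.sigma
  have hθ0 := rpow_phi_nonneg (P := P) (R.x k) A.theta
  have hσM := h.rpow_phi_le k
  have hdM := h.norm_d0 k
  have hfeas := (R.step1_solution k).1
  set β := P.beta A (R.x k) (R.d0 k) dt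
  set w := ‖R.d0 k‖ + P.phi (R.x k) ^ A.sigma with hw
  set q := (1 - β) • R.d0 k + β • dt with hq
  have hw0 : 0 ≤ w := add_nonneg (norm_nonneg _) hσ0
  have hwM : w ≤ 2 * M := by linarith
  have hωw : ω ≤ β * w := by
    refine le_trans (min_le_min ?_ ?_) hβw
    · rcases le_or_gt (ν / 2) (P.phi (R.x k) ^ A.theta) with h1 | h1
      · refine (min_le_right _ _).trans ?_
        have : (ν / 2) ^ (A.sigma / A.theta) ≤ P.phi (R.x k) ^ A.sigma := by
          calc (ν / 2) ^ (A.sigma / A.theta) ≤ (P.phi (R.x k) ^ A.theta) ^ (A.sigma / A.theta) :=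
                Real.rpow_le_rpow (by positivity) h1
                  (div_nonneg (hθ.trans A.theta_lt_sigma).le hθ.le)
            _ = P.phi (R.x k) ^ A.sigma := by
                rw [← Real.rpow_mul (phi_nonneg _)]
                congr 1
                field_simp
        linarith [norm_nonneg (R.d0 k)]
      · refine (min_le_left _ _).trans ?_
        rw [div_le_iff₀ (by positivity)]
        nlinarith [norm_nonneg (R.d0 k)]
    · gcongr
      calc min ((1 - A.theta) * a) 1 * ν
          ≤ min ((1 - A.theta) * a) 1 * (‖R.d0 k‖ ^ 2 + P.phi (R.x k) ^ A.theta) := by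
            refine mul_le_mul_of_nonneg_left hk (le_min ?_ zero_le_one)
            exact mul_nonneg (by linarith) ha.le
        _ ≤ _ := by
            rw [mul_add]
            refine add_le_add (mul_le_mul_of_nonneg_right (min_le_left _ _) (sq_nonneg _)) ?_
            exact (mul_le_mul_of_nonneg_right (min_le_right _ _) hθ0).trans (one_mul _).le
  have hqn : ‖q‖ ≤ Q := by
    have h1 : ‖dt‖ ≤ M * (2 * M) := hdt.trans (by gcongr)
    calc ‖q‖ ≤ ‖(1 - β) • R.d0 k‖ + ‖β • dt‖ := norm_add_le _ _
      _ = (1 - β) * ‖R.d0 k‖ + β * ‖dt‖ := by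
          rw [norm_smul, norm_smul, Real.norm_of_nonneg hβ0,
            Real.norm_of_nonneg (by linarith : 0 ≤ 1 - β)]
      _ ≤ 1 * M + 1 * (M * (2 * M)) := by
          gcongr
          linarith
      _ = Q := by rw [hQ]; ring
  have htq : ‖t • q‖ ≤ t * Q := by
    rw [norm_smul, Real.norm_of_nonneg ht.le]; gcongr
  obtain ⟨hT0, hT1⟩ := hC (R.x k) (t • q) ((h.norm_x k).trans (by linarith))
    ((norm_add_le _ _).trans (by nlinarith [h.norm_x k]))
  have hrem : C * ‖t • q‖ ^ 2 ≤ t * (t * (C * Q ^ 2)) := by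
    calc C * ‖t • q‖ ^ 2 ≤ C * (t * Q) ^ 2 := by gcongr
      _ = _ := by ring
  -- One inequality serves both kinds of constraints: `f_j - fbar_j` is `φ` if `f_j > 0` and `0`
  -- otherwise.
  have hcons : ∀ j, P.con j (R.x k + t • q) ≤
      P.con j (R.x k) - P.fbar j (R.x k) - A.gamma * t * β * w := by
    intro j
    have h1 := (abs_le.1 (hT1 j).2).2
    rw [inner_smul_right] at h1
    have hfb := fbar_nonpos (P := P) j (R.x k)
    have h2 : inner ℝ (P.g j (R.x k)) q =
        (1 - β) * inner ℝ (P.g j (R.x k)) (R.d0 k) + β * inner ℝ (P.g j (R.x k)) dt := by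
      rw [hq, inner_add_right, inner_smul_right, inner_smul_right]
    have h3 : inner ℝ (P.g j (R.x k)) dt = -w + P.diagD (R.x k) (R.d0 k) j * y j := by
      have := hlin j
      rw [rhsTilde] at this
      linarith
    have h4 : P.diagD (R.x k) (R.d0 k) j * y j ≤ -P.fbar j (R.x k) * H := by
      calc P.diagD (R.x k) (R.d0 k) j * y j ≤ P.diagD (R.x k) (R.d0 k) j * |y j| :=
            mul_le_mul_of_nonneg_left (le_abs_self _) (diagD_nonneg _ _ _)
        _ ≤ (|P.fbar j (R.x k)| * (3 * M ^ 2)) * (M * (2 * M)) :=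
            mul_le_mul (h.diagD_le k j) ((hy j).trans (by gcongr)) (abs_nonneg _) (by positivity)
        _ = _ := by rw [abs_of_nonpos hfb, hH]; ring
    have h5 : inner ℝ (P.g j (R.x k)) q ≤ -P.fbar j (R.x k) * (1 + H) - β * w := by
      rw [h2, h3]
      have h6 := mul_le_mul_of_nonneg_left
        (show inner ℝ (P.g j (R.x k)) (R.d0 k) ≤ -P.fbar j (R.x k) by linarith [hfeas j])
        (by linarith : 0 ≤ 1 - β)
      have h7 := mul_le_mul_of_nonneg_left h4 hβ0
      have h8 : β * (-P.fbar j (R.x k) * H) ≤ 1 * (-P.fbar j (R.x k) * H) :=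
        mul_le_mul_of_nonneg_right hβ1 (mul_nonneg (by linarith) hH0)
      have h9 := mul_nonneg hβ0 (neg_nonneg.2 hfb)
      linarith
    have h6 := mul_le_mul_of_nonneg_left h5 ht.le
    have h7 := mul_le_mul_of_nonneg_left htH (neg_nonneg.2 hfb)
    have h8 : t * (C * Q ^ 2) ≤ (1 - A.gamma) * (β * w) := by
      have := mul_le_mul_of_nonneg_left hωw (by linarith : 0 ≤ 1 - A.gamma)
      linarith
    have h9 := mul_le_mul_of_nonneg_left h8 ht.le
    linarith
  have hneg : 0 ≤ A.gamma * t * β * w := by positivity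
  refine ⟨?_, fun j hj => ?_, fun j hj => ?_⟩
  · have h1 := (abs_le.1 hT0).2
    rw [inner_smul_right] at h1
    have h2 : κ * ν ≤ A.rho * P.phi (R.x k) ^ A.theta - inner ℝ (P.g0 (R.x k)) q := by
      have h3 := mul_le_mul_of_nonneg_left hk hκ0.le
      have h4 := mul_le_mul_of_nonneg_right (min_le_left (A.rho - 1) (A.theta * a)) hθ0
      have h5 := mul_le_mul_of_nonneg_right (min_le_right (A.rho - 1) (A.theta * a))
        (sq_nonneg ‖R.d0 k‖)
      have h6 := mul_le_mul_of_nonneg_left hdesc hθ.le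
      linarith
    have h3 : t * (C * Q ^ 2) ≤
        (1 - A.gamma) * (A.rho * P.phi (R.x k) ^ A.theta - inner ℝ (P.g0 (R.x k)) q) := by
      have := mul_le_mul_of_nonneg_left h2 (by linarith : 0 ≤ 1 - A.gamma)
      linarith
    have h4 := mul_le_mul_of_nonneg_left h3 ht.le
    linarith
  · have h1 := hcons j
    have h2 : P.fbar j (R.x k) = P.con j (R.x k) - P.phi (R.x k) := by
      rw [fbar, if_neg hj.not_ge]
    linarith
  · have h1 := hcons j
    have h2 : P.fbar j (R.x k) = P.con j (R.x k) := by rw [fbar, if_pos hj]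
    linarith

/-- Step 3 never returns less than `ε`. In Step 5, either the first trial is accepted or the
preceding one was rejected and so exceeded the threshold; one factor `η` is lost. -/
theorem exists_step_lower_bound (h : R.Bounded a M) (hobj : ContDiff ℝ 2 P.obj)
    (hcon : ∀ j, ContDiff ℝ 2 (P.con j)) {ν : ℝ} (hν : 0 < ν) :
    ∃ T > 0, ∀ k, ν ≤ ‖R.d0 k‖ ^ 2 + P.phi (R.x k) ^ A.theta → T ≤ R.t k := by
  obtain ⟨T, hT, hthr⟩ := h.exists_step5_threshold hobj hcon hν
  have hη := A.eta_mem.1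
  have hη1 := A.eta_mem.2
  refine ⟨min A.eps (min 1 (A.eta * T)), ?_, fun k hk => ?_⟩
  · have := A.eps_mem.1
    positivity
  rcases (R.iteration k).trace_or_steps45 with ⟨-, -, i, -, hε, -⟩ |
    ⟨⟨dt, y, hsol, hq, i, hi, -, hfail⟩, -⟩
  · exact (min_le_left _ _).trans hε
  · refine (min_le_right _ _).trans ?_
    rcases i with _ | i
    · rw [hi, pow_zero]; exact min_le_left _ _
    · refine (min_le_right _ _).trans ?_
      rw [hi, pow_succ']
      refine mul_le_mul_of_nonneg_left ?_ hη.le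
      by_contra hlt
      rw [hq] at hfail
      exact hfail i i.lt_succ_self (hthr k hk dt y hsol _ (pow_pos hη _)
        (pow_le_one₀ hη.le hη1.le) (not_le.1 hlt).le)

/-- The product with `t_k` tends to zero, while `t_k` stays above a positive bound whenever the
measure exceeds `ν`. -/
theorem tendsto_measure (h : R.Bounded a M) (hobj : ContDiff ℝ 2 P.obj)
    (hcon : ∀ j, ContDiff ℝ 2 (P.con j)) :
    Tendsto (fun k => ‖R.d0 k‖ ^ 2 + P.phi (R.x k) ^ A.theta) atTop (𝓝 0) := by
  have hnn : ∀ k, 0 ≤ ‖R.d0 k‖ ^ 2 + P.phi (R.x k) ^ A.theta := fun k =>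
    add_nonneg (sq_nonneg _) (rpow_phi_nonneg _ _)
  rw [Metric.tendsto_nhds]
  intro ν hν
  obtain ⟨T, hT, hstep⟩ := h.exists_step_lower_bound hobj hcon hν
  have h1 := h.tendsto_step_mul.eventually (gt_mem_nhds (mul_pos hT hν))
  filter_upwards [h1] with k hk
  rw [Real.dist_0_eq_abs, abs_of_nonneg (hnn k)]
  by_contra hge
  have hge := not_lt.1 hge
  exact absurd hk (mul_le_mul (hstep k hge) hge hν.le (hT.le.trans (hstep k hge))).not_gt

theorem tendsto_rpow_theta (h : R.Bounded a M) (hobj : ContDiff ℝ 2 P.obj)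
    (hcon : ∀ j, ContDiff ℝ 2 (P.con j)) :
    Tendsto (fun k => P.phi (R.x k) ^ A.theta) atTop (𝓝 0) :=
  squeeze_zero (fun _ => rpow_phi_nonneg _ _) (fun _ => le_add_of_nonneg_left (sq_nonneg _))
    (h.tendsto_measure hobj hcon)

theorem tendsto_norm_d0 (h : R.Bounded a M) (hobj : ContDiff ℝ 2 P.obj)
    (hcon : ∀ j, ContDiff ℝ 2 (P.con j)) : Tendsto (fun k => ‖R.d0 k‖) atTop (𝓝 0) := by
  have h1 : Tendsto (fun k => ‖R.d0 k‖ ^ 2) atTop (𝓝 0) :=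
    squeeze_zero (fun _ => sq_nonneg _) (fun _ => le_add_of_nonneg_right (rpow_phi_nonneg _ _))
      (h.tendsto_measure hobj hcon)
  have := h1.sqrt
  simpa [Real.sqrt_sq (norm_nonneg _)] using this

theorem tendsto_phi (h : R.Bounded a M) (hobj : ContDiff ℝ 2 P.obj)
    (hcon : ∀ j, ContDiff ℝ 2 (P.con j)) : Tendsto (fun k => P.phi (R.x k)) atTop (𝓝 0) := by
  have hθ := A.theta_pos
  have := (h.tendsto_rpow_theta hobj hcon).rpow_const (p := 1 / A.theta)
    (Or.inr (by positivity))
  rw [Real.zero_rpow (by positivity)] at this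
  refine this.congr fun k => ?_
  rw [← Real.rpow_mul (phi_nonneg _), mul_one_div_cancel hθ.ne', Real.rpow_one]

theorem tendsto_rpow_phi (h : R.Bounded a M) (hobj : ContDiff ℝ 2 P.obj)
    (hcon : ∀ j, ContDiff ℝ 2 (P.con j)) {s : ℝ} (hs : 0 < s) :
    Tendsto (fun k => P.phi (R.x k) ^ s) atTop (𝓝 0) := by
  have := (h.tendsto_phi hobj hcon).rpow_const (p := s) (Or.inr hs.le)
  rwa [Real.zero_rpow hs.ne'] at this

/-- The correction direction is of the order of `‖d₀‖² + φ ^ σ`. -/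
theorem exists_correction_bound (h : R.Bounded a M) (hobj : ContDiff ℝ 2 P.obj)
    (hcon : ∀ j, ContDiff ℝ 2 (P.con j)) :
    ∃ C > 0, ∀ k, ‖R.d1 k‖ ≤ C * (‖R.d0 k‖ ^ 2 + P.phi (R.x k) ^ A.sigma) ∧
      ∀ j, |R.h1 k j| ≤ C * (‖R.d0 k‖ ^ 2 + P.phi (R.x k) ^ A.sigma) := by
  have hM := h.pos
  obtain ⟨C, hC0, hC⟩ := exists_uniform_taylor_bound hobj hcon (M + M)
  refine ⟨M * (M + 1 + C), by positivity, fun k => ?_⟩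
  have hσ0 := rpow_phi_nonneg (P := P) (R.x k) A.sigma
  have hτ : ‖R.d0 k‖ ^ A.tau ≤ M * ‖R.d0 k‖ ^ 2 := by
    have hτ2 := A.tau_mem.1
    have hτ3 := A.tau_mem.2
    have h1 : ‖R.d0 k‖ ^ A.tau = ‖R.d0 k‖ ^ (A.tau - 2) * ‖R.d0 k‖ ^ 2 := by
      rw [← Real.rpow_natCast, ← Real.rpow_add_of_nonneg (norm_nonneg _) (by linarith) (by simp)]
      congr 1; push_cast; ring
    rw [h1]
    refine mul_le_mul_of_nonneg_right ?_ (sq_nonneg _)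
    calc ‖R.d0 k‖ ^ (A.tau - 2) ≤ M ^ (A.tau - 2) :=
          Real.rpow_le_rpow (norm_nonneg _) (h.norm_d0 k) (by linarith)
      _ ≤ M ^ (1 : ℝ) := Real.rpow_le_rpow_of_exponent_le h.one_le (by linarith)
      _ = M := Real.rpow_one M
  have hr : ∀ j, |P.rhsCorrection A (R.x k) (R.d0 k) j| ≤
      (M + 1 + C) * (‖R.d0 k‖ ^ 2 + P.phi (R.x k) ^ A.sigma) := by
    intro j
    have h1 := ((hC (R.x k) (R.d0 k) ((h.norm_x k).trans (by linarith))
      ((norm_add_le _ _).trans (add_le_add (h.norm_x k) (h.norm_d0 k)))).2 j).2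
    have h2 : 0 ≤ ‖R.d0 k‖ ^ A.tau := Real.rpow_nonneg (norm_nonneg _) _
    have h3 : 0 ≤ M * P.phi (R.x k) ^ A.sigma := by positivity
    have h4 : 0 ≤ C * P.phi (R.x k) ^ A.sigma := by positivity
    have h5 := sq_nonneg ‖R.d0 k‖
    obtain ⟨h6, h7⟩ := abs_le.1 h1
    rw [rhsCorrection, abs_le]
    constructor <;> linarith
  have := h.sle k (R.step2_correction k) (by positivity) hr
  simpa only [mul_assoc] using this

theorem tendsto_correction_size (h : R.Bounded a M) (hobj : ContDiff ℝ 2 P.obj)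
    (hcon : ∀ j, ContDiff ℝ 2 (P.con j)) :
    Tendsto (fun k => ‖R.d0 k‖ ^ 2 + P.phi (R.x k) ^ A.sigma) atTop (𝓝 0) := by
  simpa using ((h.tendsto_norm_d0 hobj hcon).pow 2).add
    (h.tendsto_rpow_phi hobj hcon (A.theta_pos.trans A.theta_lt_sigma))

theorem tendsto_norm_d1 (h : R.Bounded a M) (hobj : ContDiff ℝ 2 P.obj)
    (hcon : ∀ j, ContDiff ℝ 2 (P.con j)) : Tendsto (fun k => ‖R.d1 k‖) atTop (𝓝 0) := by
  obtain ⟨C, -, hC⟩ := h.exists_correction_bound hobj hcon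
  refine squeeze_zero (fun _ => norm_nonneg _) (fun k => (hC k).1) ?_
  simpa using (h.tendsto_correction_size hobj hcon).const_mul C

/-- Needed to exclude oscillation between cluster points. The bound covers both possible directions.
-/
theorem tendsto_increment (h : R.Bounded a M) (hobj : ContDiff ℝ 2 P.obj)
    (hcon : ∀ j, ContDiff ℝ 2 (P.con j)) :
    Tendsto (fun k => ‖R.x (k + 1) - R.x k‖) atTop (𝓝 0) := by
  have hM := h.pos
  have hd0 := h.tendsto_norm_d0 hobj hcon
  have hlim : Tendsto (fun k => ‖R.d0 k‖ + ‖R.d1 k‖ +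
      M * (‖R.d0 k‖ + P.phi (R.x k) ^ A.sigma)) atTop (𝓝 0) := by
    simpa using (hd0.add (h.tendsto_norm_d1 hobj hcon)).add
      ((hd0.add (h.tendsto_rpow_phi hobj hcon (A.theta_pos.trans A.theta_lt_sigma))).const_mul M)
  refine squeeze_zero (fun _ => norm_nonneg _) (fun k => ?_) hlim
  obtain ⟨ht, ht1⟩ := step_pos_le_one R k
  have hσ0 := rpow_phi_nonneg (P := P) (R.x k) A.sigma
  rw [R.step6_update k, add_sub_cancel_left, norm_smul, Real.norm_of_nonneg ht.le]
  refine (mul_le_of_le_one_left (norm_nonneg _) ht1).trans ?_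
  rcases (R.iteration k).trace_or_steps45 with ⟨-, hq, -⟩ | ⟨⟨dt, y, hsol, hq, -⟩, -⟩
  · rw [hq]
    have : 0 ≤ M * (‖R.d0 k‖ + P.phi (R.x k) ^ A.sigma) := by positivity
    linarith [norm_add_le (R.d0 k) (R.d1 k)]
  · have hdesc0 : inner ℝ (P.g0 (R.x k)) (R.d0 k) ≤ 0 := (h.inner_g0_le k).trans (by
      have := h.a_pos
      have : 0 ≤ a * ‖R.d0 k‖ ^ 2 := by positivity
      linarith)
    obtain ⟨hβ0, hβ1⟩ := beta_nonneg_le_one (P := P) (A := A) (dt := dt) hdesc0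
    rw [hq]
    refine (norm_add_le _ _).trans ?_
    rw [norm_smul, norm_smul, Real.norm_of_nonneg hβ0, Real.norm_of_nonneg (by linarith)]
    have h1 := mul_le_of_le_one_left (norm_nonneg dt) hβ1
    have h2 := mul_le_of_le_one_left (norm_nonneg (R.d0 k)) (by linarith :
      1 - P.beta A (R.x k) (R.d0 k) dt ≤ 1)
    linarith [(h.tilde_bound hsol).1, norm_nonneg (R.d1 k)]

end Run.Bounded
end NLProblem

/-! ### Convergence to an isolated cluster point. -/

/-- A bounded sequence with vanishing increments converges to any isolated cluster point. -/
theorem tendsto_of_isolated_mapClusterPt {E : Type*} [NormedAddCommGroup E] [ProperSpace E]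
    {x : ℕ → E} {z : E} (hinc : Tendsto (fun k => ‖x (k + 1) - x k‖) atTop (𝓝 0))
    (hz : MapClusterPt z atTop x) {r : ℝ} (hr : 0 < r)
    (hiso : ∀ y, MapClusterPt y atTop x → ‖y - z‖ < r → y = z) : Tendsto x atTop (𝓝 z) := by
  by_contra hnot
  rw [Metric.tendsto_atTop] at hnot
  push Not at hnot
  obtain ⟨ε, hε, hfar⟩ := hnot
  set δ := min ε (r / 2) with hδ
  have hδ0 : 0 < δ := lt_min hε (by positivity)
  -- If convergence fails, the sequence returns to the ball of radius `δ / 2` and leaves it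
  -- infinitely often. With steps shorter than `δ / 2` it lands in this shell, where compactness
  -- gives a second cluster point within distance `r` of `z`.
  let S : Set E := Metric.closedBall z δ ∩ {y | δ / 2 ≤ dist y z}
  have hS : IsCompact S := (isCompact_closedBall z δ).inter_right
    (isClosed_le continuous_const (continuous_id.dist continuous_const))
  have hfreq : ∃ᶠ k in atTop, x k ∈ S := by
    rw [frequently_atTop]
    intro N
    obtain ⟨N₁, hN₁⟩ := eventually_atTop.1 (hinc.eventually (gt_mem_nhds (half_pos hδ0)))
    have hnear := mapClusterPt_iff_frequently.1 hz _ (Metric.ball_mem_nhds z (half_pos hδ0))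
    obtain ⟨k₁, hk₁, hk₁x⟩ := frequently_atTop.1 hnear (max N N₁)
    obtain ⟨k₂, hk₂, hk₂x⟩ := hfar k₁
    have hex : ∃ i, δ / 2 ≤ dist (x (k₁ + i)) z :=
      ⟨k₂ - k₁, by rw [Nat.add_sub_cancel' hk₂]; linarith [min_le_left ε (r / 2)]⟩
    classical
    have hspec := Nat.find_spec hex
    have hmin := fun i (hi : i < Nat.find hex) => Nat.find_min hex hi
    -- The first exit index is not `0`, since `x k₁` lies in the inner ball; its predecessor
    -- therefore exists and is still inside.
    rcases hi : Nat.find hex with _ | i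
    · rw [hi] at hspec
      exact absurd hk₁x (by simpa using hspec)
    · rw [hi] at hspec hmin
      have h1 := not_le.1 (hmin i i.lt_succ_self)
      have h2 := hN₁ (k₁ + i) (by omega)
      refine ⟨k₁ + (i + 1), by omega, ?_, hspec⟩
      rw [Metric.mem_closedBall]
      have h3 := dist_triangle (x (k₁ + (i + 1))) (x (k₁ + i)) z
      have h4 : dist (x (k₁ + (i + 1))) (x (k₁ + i)) = ‖x (k₁ + i + 1) - x (k₁ + i)‖ :=
        dist_eq_norm _ _
      linarith
  obtain ⟨y, hyS, hy⟩ := hS.exists_mapClusterPt_of_frequently hfreq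
  have hyz := hiso y hy (by
    rw [← dist_eq_norm]
    have := Metric.mem_closedBall.1 hyS.1
    linarith [min_le_right ε (r / 2)])
  have : δ / 2 ≤ dist y z := hyS.2
  rw [hyz, dist_self] at this
  linarith

/-! ### Convergence of multipliers, isolation of KKT points, global convergence. -/

namespace NLProblem

variable {n m : ℕ} {P : NLProblem n m} {A : AlgParams} {R : P.Run A} {a M : ℝ}

/-- `fbar` is not continuous, but it differs from `f_j` by at most `φ`, which vanishes here. -/
theorem tendsto_fbar {ι : Type*} {l : Filter ι} {x : ι → EuclideanSpace ℝ (Fin n)}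
    {z : EuclideanSpace ℝ (Fin n)} (hcon : ∀ j, Continuous (P.con j)) (hx : Tendsto x l (𝓝 z))
    (hφ : Tendsto (fun i => P.phi (x i)) l (𝓝 0)) (j : Fin m) :
    Tendsto (fun i => P.fbar j (x i)) l (𝓝 (P.con j z)) := by
  have h1 : Tendsto (fun i => P.fbar j (x i) - P.con j (x i)) l (𝓝 0) :=
    squeeze_zero_norm (fun i => abs_fbar_sub_con_le j (x i)) hφ
  simpa using h1.add (((hcon j).tendsto z).comp hx)

/-- Approximate multipliers converge to the multiplier of the limiting KKT pair. -/
theorem IsKKTPair.tendsto_multiplier {ι : Type*} {l : Filter ι}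
    {x : ι → EuclideanSpace ℝ (Fin n)} {z : EuclideanSpace ℝ (Fin n)} {lam : Fin m → ℝ}
    {mu : ι → Fin m → ℝ} (hkkt : P.IsKKTPair z lam) (hindep : P.GradientsIndependent)
    (hobj : ContDiff ℝ 2 P.obj) (hcon : ∀ j, ContDiff ℝ 2 (P.con j))
    (hx : Tendsto x l (𝓝 z)) (hφ : Tendsto (fun i => P.phi (x i)) l (𝓝 0))
    (hstat : Tendsto (fun i => P.g0 (x i) + ∑ j, mu i j • P.g j (x i)) l (𝓝 0))
    (hcomp : ∀ j, Tendsto (fun i => mu i j * P.fbar j (x i)) l (𝓝 0)) (j : Fin m) :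
    Tendsto (fun i => mu i j) l (𝓝 (lam j)) := by
  have hfc : ∀ j, Continuous (P.con j) := fun j => (hcon j).continuous
  obtain ⟨c, hc, hgram⟩ := exists_gram_lower_bound (continuous_g hcon) hfc hindep
    (isCompact_closedBall z 1)
  have hgx : ∀ j, Tendsto (fun i => P.g j (x i)) l (𝓝 (P.g j z)) := fun j =>
    ((continuous_g hcon j).tendsto z).comp hx
  -- The Gram bound is applied to `mu - lam`: its gradient combination and its `fbar`-weighted
  -- entries both tend to zero.
  have hlim1 : Tendsto (fun i => ∑ j, (mu i j - lam j) • P.g j (x i)) l (𝓝 0) := by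
    have h1 : Tendsto (fun i => P.g0 (x i) + ∑ j, lam j • P.g j (x i)) l (𝓝 0) := by
      rw [← hkkt.stationary]
      exact (((continuous_g0 hobj).tendsto z).comp hx).add
        (tendsto_finsetSum _ fun j _ => (hgx j).const_smul (lam j))
    have h2 := hstat.sub h1
    rw [sub_zero] at h2
    refine h2.congr fun i => ?_
    simp only [sub_smul, Finset.sum_sub_distrib]
    abel
  have hlim2 : ∀ j, Tendsto (fun i => P.fbar j (x i) * (mu i j - lam j)) l (𝓝 0) := by
    intro j
    have h1 := (hcomp j).sub ((tendsto_fbar hfc hx hφ j).const_mul (lam j))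
    rw [hkkt.complementary j, sub_zero] at h1
    exact h1.congr fun i => by ring
  have hlim : Tendsto (fun i => c⁻¹ * (‖∑ j, (mu i j - lam j) • P.g j (x i)‖ ^ 2 +
      ∑ j, (P.fbar j (x i) * (mu i j - lam j)) ^ 2)) l (𝓝 0) := by
    have h1 := (hlim1.norm.pow 2).add
      (tendsto_finsetSum Finset.univ fun j _ => (hlim2 j).pow 2)
    simpa using h1.const_mul c⁻¹
  have hsq : Tendsto (fun i => (mu i j - lam j) ^ 2) l (𝓝 0) := by
    refine squeeze_zero' (Eventually.of_forall fun _ => sq_nonneg _) ?_ hlim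
    filter_upwards [hx.eventually (Metric.closedBall_mem_nhds z one_pos)] with i hi
    rw [le_inv_mul_iff₀ hc]
    refine le_trans ?_ (hgram _ hi fun j => mu i j - lam j)
    gcongr
    exact Finset.single_le_sum (f := fun j => (mu i j - lam j) ^ 2) (fun j _ => sq_nonneg _)
      (Finset.mem_univ j)
  have habs := hsq.sqrt
  simp only [Real.sqrt_sq_eq_abs, Real.sqrt_zero] at habs
  rw [tendsto_iff_norm_sub_tendsto_zero]
  exact habs

theorem IsKKTPair.phi_eq_zero {x : EuclideanSpace ℝ (Fin n)} {lam : Fin m → ℝ}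
    (h : P.IsKKTPair x lam) : P.phi x = 0 :=
  le_antisymm (phi_le_iff.2 ⟨le_rfl, h.feasible⟩) (phi_nonneg x)

theorem IsKKTPair.fbar_eq {x : EuclideanSpace ℝ (Fin n)} {lam : Fin m → ℝ}
    (h : P.IsKKTPair x lam) (j : Fin m) : P.fbar j x = P.con j x := if_pos (h.feasible j)

theorem gradient_lagrangian (hobj : ContDiff ℝ 2 P.obj) (hcon : ∀ j, ContDiff ℝ 2 (P.con j))
    (lam : Fin m → ℝ) :
    gradient (P.lagrangian lam) = fun x => P.g0 x + ∑ j, lam j • P.g j x := by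
  funext x
  have h0 : HasGradientAt P.obj (P.g0 x) x :=
    (hobj.differentiable (by norm_num) x).hasGradientAt
  have h1 : ∀ j, HasGradientAt (P.con j) (P.g j x) x := fun j =>
    ((hcon j).differentiable (by norm_num) x).hasGradientAt
  refine HasGradientAt.gradient ?_
  rw [hasGradientAt_iff_hasFDerivAt]
  refine (h0.hasFDerivAt.add
    (HasFDerivAt.fun_sum fun j _ => (h1 j).hasFDerivAt.const_mul (lam j))).congr_fderiv ?_
  simp [map_add, map_sum]

theorem contDiff_lagrangian (hobj : ContDiff ℝ 2 P.obj) (hcon : ∀ j, ContDiff ℝ 2 (P.con j))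
    (lam : Fin m → ℝ) : ContDiff ℝ 2 (P.lagrangian lam) :=
  hobj.add (ContDiff.sum fun j _ => contDiff_const.mul (hcon j))

theorem hessL_apply (hobj : ContDiff ℝ 2 P.obj) (hcon : ∀ j, ContDiff ℝ 2 (P.con j))
    (lam : Fin m → ℝ) (x d : EuclideanSpace ℝ (Fin n)) :
    P.hessL x lam d = fderiv ℝ P.g0 x d + ∑ j, lam j • fderiv ℝ (P.g j) x d := by
  have h0 : DifferentiableAt ℝ P.g0 x :=
    (contDiff_gradient hobj).differentiable (by norm_num) x
  have h1 : ∀ j, DifferentiableAt ℝ (P.g j) x := fun j =>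
    (contDiff_gradient (hcon j)).differentiable (by norm_num) x
  rw [hessL, gradient_lagrangian hobj hcon]
  have h2 : HasFDerivAt (fun x => P.g0 x + ∑ j, lam j • P.g j x)
      (fderiv ℝ P.g0 x + ∑ j, lam j • fderiv ℝ (P.g j) x) x :=
    h0.hasFDerivAt.add (HasFDerivAt.fun_sum fun j _ => (h1 j).hasFDerivAt.const_smul (lam j))
  rw [h2.fderiv]
  simp

/-- Under the strong second-order condition a KKT point is isolated. -/
theorem IsKKTPair.isolated {z : EuclideanSpace ℝ (Fin n)} {lam : Fin m → ℝ}
    (hkkt : P.IsKKTPair z lam) (hss : P.StrongSecondOrder z lam)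
    (hindep : P.GradientsIndependent)
    (hobj : ContDiff ℝ 2 P.obj) (hcon : ∀ j, ContDiff ℝ 2 (P.con j)) :
    ∃ r > 0, ∀ y mu, P.IsKKTPair y mu → ‖y - z‖ < r → y = z := by
  by_contra hnot
  push Not at hnot
  set S : Set (EuclideanSpace ℝ (Fin n)) := {y | y ≠ z ∧ ∃ mu, P.IsKKTPair y mu} with hSdef
  have hne : (𝓝 z ⊓ 𝓟 S).NeBot := by
    refine mem_closure_iff_nhdsWithin_neBot.1 ?_
    rw [Metric.mem_closure_iff]
    intro ε hε
    obtain ⟨y, mu, hy, hyz, hyne⟩ := hnot ε hε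
    exact ⟨y, ⟨hyne, mu, hy⟩, by rwa [dist_comm, dist_eq_norm]⟩
  -- An ultrafilter on the other KKT points near `z` replaces subsequences: the normalized
  -- directions `(y - z)/‖y - z‖` converge along it by compactness.
  set U := Ultrafilter.of (𝓝 z ⊓ 𝓟 S) with hU
  have hUle : (U : Filter (EuclideanSpace ℝ (Fin n))) ≤ 𝓝 z ⊓ 𝓟 S := Ultrafilter.of_le _
  have hUz : Tendsto (fun y => y) (U : Filter (EuclideanSpace ℝ (Fin n))) (𝓝 z) := hUle.trans inf_le_left
  have hUS : ∀ᶠ y in (U : Filter (EuclideanSpace ℝ (Fin n))), y ∈ S := hUle.trans inf_le_right (mem_principal_self S)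
  have hex : ∀ y, ∃ mu : Fin m → ℝ, y ∈ S → P.IsKKTPair y mu := by
    intro y
    by_cases hy : y ∈ S
    · obtain ⟨mu, hmu⟩ := hy.2
      exact ⟨mu, fun _ => hmu⟩
    · exact ⟨0, fun h => absurd h hy⟩
  choose mu hmu using hex
  have hmulim : ∀ j, Tendsto (fun y => mu y j) (U : Filter (EuclideanSpace ℝ (Fin n))) (𝓝 (lam j)) := by
    refine hkkt.tendsto_multiplier hindep hobj hcon hUz ?_ ?_ ?_
    · exact tendsto_const_nhds.congr' (hUS.mono fun y hy => (hmu y hy).phi_eq_zero.symm)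
    · exact tendsto_const_nhds.congr' (hUS.mono fun y hy => (hmu y hy).stationary.symm)
    · intro j
      refine tendsto_const_nhds.congr' (hUS.mono fun y hy => ?_)
      simp only [(hmu y hy).fbar_eq, (hmu y hy).complementary]
  obtain ⟨C, hC0, hC⟩ := exists_uniform_taylor_bound hobj hcon (‖z‖ + 1)
  have hUball : ∀ᶠ y in (U : Filter (EuclideanSpace ℝ (Fin n))), ‖y‖ ≤ ‖z‖ + 1 := by
    filter_upwards [hUz.eventually (Metric.closedBall_mem_nhds z one_pos)] with y hy
    rw [dist_eq_norm] at hy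
    have := norm_add_le (y - z) z
    rw [sub_add_cancel] at this
    linarith
  have htay : ∀ᶠ y in (U : Filter (EuclideanSpace ℝ (Fin n))), ∀ j,
      |P.con j y - P.con j z - inner ℝ (P.g j y) (y - z)| ≤ C * ‖y - z‖ ^ 2 := by
    filter_upwards [hUball] with y hy j
    have := ((hC y (z - y) hy (by simp)).2 j).2
    rw [add_sub_cancel, ← neg_sub y z, norm_neg, inner_neg_right, ← abs_neg] at this
    convert this using 2
    ring
  set u : EuclideanSpace ℝ (Fin n) → EuclideanSpace ℝ (Fin n) := fun y => ‖y - z‖⁻¹ • (y - z)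
  have hun : ∀ᶠ y in (U : Filter (EuclideanSpace ℝ (Fin n))), u y ∈ Metric.sphere (0 : EuclideanSpace ℝ (Fin n)) 1 := by
    filter_upwards [hUS] with y hy
    have : ‖y - z‖ ≠ 0 := norm_ne_zero_iff.2 (sub_ne_zero.2 hy.1)
    simp [u, norm_smul, this]
  obtain ⟨v, hv, hvlim⟩ := (isCompact_sphere (0 : EuclideanSpace ℝ (Fin n)) 1).ultrafilter_le_nhds
    (U.map u) (le_principal_iff.2 hun)
  have hulim : Tendsto u (U : Filter (EuclideanSpace ℝ (Fin n))) (𝓝 v) := hvlim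
  have hvne : v ≠ 0 := by
    rintro rfl
    simp at hv
  have hnlim : Tendsto (fun y => ‖y - z‖) (U : Filter (EuclideanSpace ℝ (Fin n))) (𝓝 0) :=
    tendsto_iff_norm_sub_tendsto_zero.1 hUz
  -- If `lam j > 0`, then `mu y j > 0` near `z`, so `f_j` vanishes at both `y` and `z`, and the
  -- limit direction is tangent to this constraint.
  have hvcone : ∀ j, 0 < lam j → inner ℝ (P.g j z) v = 0 := by
    intro j hj
    have h1 : Tendsto (fun y => inner ℝ (P.g j y) (u y)) (U : Filter (EuclideanSpace ℝ (Fin n)))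
        (𝓝 (inner ℝ (P.g j z) v)) :=
      (((continuous_g hcon j).tendsto z).comp hUz).inner hulim
    have h2 : Tendsto (fun y => inner ℝ (P.g j y) (u y)) (U : Filter (EuclideanSpace ℝ (Fin n))) (𝓝 0) := by
      refine squeeze_zero_norm' ?_ (by simpa using hnlim.const_mul C)
      filter_upwards [hUS, htay, (hmulim j).eventually (lt_mem_nhds hj)] with y hy hty hmuy
      have h3 : P.con j y = 0 :=
        (mul_eq_zero.1 ((hmu y hy).complementary j)).resolve_left hmuy.ne'
      have h4 : P.con j z = 0 := (mul_eq_zero.1 (hkkt.complementary j)).resolve_left hj.ne'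
      have h5 := hty j
      rw [h3, h4, sub_zero, zero_sub, abs_neg] at h5
      have hpos : 0 < ‖y - z‖ := norm_pos_iff.2 (sub_ne_zero.2 hy.1)
      rw [inner_smul_right, Real.norm_eq_abs, abs_mul, abs_inv, abs_norm, inv_mul_le_iff₀ hpos]
      linarith
    exact tendsto_nhds_unique h1 h2
  have hgl := gradient_lagrangian hobj hcon lam
  have hderiv : HasFDerivAt (gradient (P.lagrangian lam)) (P.hessL z lam) z :=
    ((contDiff_gradient (contDiff_lagrangian hobj hcon lam)).differentiable
      (by norm_num) z).hasFDerivAt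
  have hglz : gradient (P.lagrangian lam) z = 0 := by rw [hgl]; exact hkkt.stationary
  have hHlim : Tendsto (fun y => ‖y - z‖⁻¹ • gradient (P.lagrangian lam) y) (U : Filter (EuclideanSpace ℝ (Fin n)))
      (𝓝 (P.hessL z lam v)) := by
    have h1 := (hasFDerivAt_iff_tendsto.1 hderiv).comp hUz
    have h2 : Tendsto (fun y => ‖y - z‖⁻¹ • (gradient (P.lagrangian lam) y
        - gradient (P.lagrangian lam) z - P.hessL z lam (y - z))) (U : Filter (EuclideanSpace ℝ (Fin n))) (𝓝 0) := by
      rw [tendsto_zero_iff_norm_tendsto_zero]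
      refine h1.congr fun y => ?_
      simp [norm_smul]
    have h3 := h2.add (((P.hessL z lam).continuous.tendsto v).comp hulim)
    rw [zero_add] at h3
    refine h3.congr fun y => ?_
    simp [u, hglz, smul_sub]
  -- `∇L(y, lam) = -∑ (mu - lam)_j g_j(y)`, and complementarity makes `(mu - lam)_j (f_j(y) -
  -- f_j(z))` nonnegative. The Taylor error carries the factor `|mu - lam| → 0`, so the curvature
  -- along `v` is at most zero, against the second-order condition.
  have hle : inner ℝ v (P.hessL z lam v) ≤ 0 := by
    have h1 : Tendsto (fun y => inner ℝ (u y) (‖y - z‖⁻¹ • gradient (P.lagrangian lam) y))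
        (U : Filter (EuclideanSpace ℝ (Fin n))) (𝓝 (inner ℝ v (P.hessL z lam v))) := hulim.inner hHlim
    have h2 : Tendsto (fun y => ∑ j, |mu y j - lam j| * C) (U : Filter (EuclideanSpace ℝ (Fin n))) (𝓝 0) := by
      have := tendsto_finsetSum Finset.univ fun j (_ : j ∈ Finset.univ) =>
        (((hmulim j).sub_const (lam j)).abs.mul_const C)
      simpa using this
    refine le_of_tendsto_of_tendsto h1 h2 ?_
    filter_upwards [hUS, htay] with y hy hty
    have hpos : 0 < ‖y - z‖ := norm_pos_iff.2 (sub_ne_zero.2 hy.1)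
    have hK := hmu y hy
    have h3 : gradient (P.lagrangian lam) y = -∑ j, (mu y j - lam j) • P.g j y := by
      rw [hgl, eq_neg_iff_add_eq_zero, ← hK.stationary]
      simp only [sub_smul, Finset.sum_sub_distrib]
      abel
    have h4 : inner ℝ (y - z) (gradient (P.lagrangian lam) y) ≤
        (∑ j, |mu y j - lam j| * C) * ‖y - z‖ ^ 2 := by
      rw [h3, inner_neg_right, inner_sum, ← Finset.sum_neg_distrib, Finset.sum_mul]
      refine Finset.sum_le_sum fun j _ => ?_
      rw [inner_smul_right, real_inner_comm]
      have h5 : 0 ≤ (mu y j - lam j) * (P.con j y - P.con j z) := by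
        have e1 := hK.complementary j
        have e2 := hkkt.complementary j
        have e3 := mul_nonneg (hkkt.nonneg j) (neg_nonneg.2 (hK.feasible j))
        have e4 := mul_nonneg (hK.nonneg j) (neg_nonneg.2 (hkkt.feasible j))
        linarith
      have h6 : (mu y j - lam j) *
          (P.con j y - P.con j z - inner ℝ (P.g j y) (y - z)) ≤
          |mu y j - lam j| * (C * ‖y - z‖ ^ 2) := by
        refine (le_abs_self _).trans ?_
        rw [abs_mul]
        exact mul_le_mul_of_nonneg_left (hty j) (abs_nonneg _)
      linarith
    rw [inner_smul_left, inner_smul_right]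
    simp only [map_inv₀, conj_trivial]
    rw [inv_mul_le_iff₀ hpos, inv_mul_le_iff₀ hpos]
    linarith
  exact absurd (hss v hvne hvcone) hle.not_gt

namespace Run.Bounded

/-- In the Gram bound for `λ^k`, complementarity turns `fbar_j λ_j` into `-λ_j g_jᵀd0`. Once `d0` is
small, this part is absorbed into half of the left side. -/
theorem eventually_norm_lam_le (h : R.Bounded a M) (hindep : P.GradientsIndependent)
    (hobj : ContDiff ℝ 2 P.obj) (hcon : ∀ j, ContDiff ℝ 2 (P.con j)) :
    ∃ Λ, 0 ≤ Λ ∧ ∀ᶠ k in atTop, ∀ j, |R.lam k j| ≤ Λ := by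
  have hM := h.pos
  obtain ⟨c, hc, hgram⟩ := exists_gram_lower_bound (continuous_g hcon)
    (fun j => (hcon j).continuous) hindep
    (isCompact_closedBall (0 : EuclideanSpace ℝ (Fin n)) M)
  refine ⟨√((M + M * M) ^ 2 * 2 / c), Real.sqrt_nonneg _, ?_⟩
  have hsmall : ∀ᶠ k in atTop, M ^ 2 * ‖R.d0 k‖ ^ 2 < c / 2 := by
    have : Tendsto (fun k => M ^ 2 * ‖R.d0 k‖ ^ 2) atTop (𝓝 0) := by
      simpa using ((h.tendsto_norm_d0 hobj hcon).pow 2).const_mul (M ^ 2)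
    exact this.eventually (gt_mem_nhds (by positivity))
  filter_upwards [hsmall] with k hk j
  have hmul := R.step1_multiplier k
  have h1 := hgram (R.x k) (by simpa using h.norm_x k) (R.lam k)
  have h2 : ‖∑ j, R.lam k j • P.g j (R.x k)‖ ≤ M + M * M := by
    have : ∑ j, R.lam k j • P.g j (R.x k) = -(P.g0 (R.x k) + matVec (R.B k) (R.d0 k)) := by
      rw [eq_neg_iff_add_eq_zero, add_comm]; exact hmul.stationary
    rw [this, norm_neg]
    refine (norm_add_le _ _).trans (add_le_add (h.norm_g0 k) ((h.norm_matVec k _).trans ?_))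
    gcongr
    exact h.norm_d0 k
  have h3 : ∑ j, (P.fbar j (R.x k) * R.lam k j) ^ 2 ≤ c / 2 * ∑ j, R.lam k j ^ 2 := by
    rw [Finset.mul_sum]
    refine Finset.sum_le_sum fun j _ => ?_
    have h4 : P.fbar j (R.x k) * R.lam k j = -(R.lam k j * inner ℝ (P.g j (R.x k)) (R.d0 k)) := by
      have := hmul.complementary j
      linarith
    have h5 : inner ℝ (P.g j (R.x k)) (R.d0 k) ^ 2 ≤ M ^ 2 * ‖R.d0 k‖ ^ 2 := by
      rw [← mul_pow, ← sq_abs]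
      refine pow_le_pow_left₀ (abs_nonneg _) ((abs_real_inner_le_norm _ _).trans ?_) 2
      gcongr
      exact h.norm_g k j
    rw [h4, neg_sq, mul_pow]
    nlinarith [sq_nonneg (R.lam k j)]
  have h4 : ‖∑ j, R.lam k j • P.g j (R.x k)‖ ^ 2 ≤ (M + M * M) ^ 2 :=
    pow_le_pow_left₀ (norm_nonneg _) h2 2
  refine Real.abs_le_sqrt ?_
  have h5 := Finset.single_le_sum (f := fun j => R.lam k j ^ 2) (fun j _ => sq_nonneg _)
    (Finset.mem_univ j)
  rw [le_div_iff₀ hc]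
  nlinarith

theorem tendsto_inner_g_d0 (h : R.Bounded a M) (hobj : ContDiff ℝ 2 P.obj)
    (hcon : ∀ j, ContDiff ℝ 2 (P.con j)) (j : Fin m) :
    Tendsto (fun k => inner ℝ (P.g j (R.x k)) (R.d0 k)) atTop (𝓝 0) := by
  refine squeeze_zero_norm (fun k => (norm_inner_le_norm _ _).trans
    (mul_le_mul_of_nonneg_right (h.norm_g k j) (norm_nonneg _))) ?_
  simpa using (h.tendsto_norm_d0 hobj hcon).const_mul M

theorem tendsto_lam_mul_fbar (h : R.Bounded a M) (hindep : P.GradientsIndependent)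
    (hobj : ContDiff ℝ 2 P.obj) (hcon : ∀ j, ContDiff ℝ 2 (P.con j)) (j : Fin m) :
    Tendsto (fun k => R.lam k j * P.fbar j (R.x k)) atTop (𝓝 0) := by
  obtain ⟨Λ, -, hΛ⟩ := h.eventually_norm_lam_le hindep hobj hcon
  have hlim : Tendsto (fun k => Λ * |inner ℝ (P.g j (R.x k)) (R.d0 k)|) atTop (𝓝 0) := by
    simpa using (h.tendsto_inner_g_d0 hobj hcon j).abs.const_mul Λ
  refine squeeze_zero_norm' ?_ hlim
  filter_upwards [hΛ] with k hk
  have h4 : R.lam k j * P.fbar j (R.x k) = -(R.lam k j * inner ℝ (P.g j (R.x k)) (R.d0 k)) := by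
    have := (R.step1_multiplier k).complementary j
    linarith
  rw [h4, norm_neg, Real.norm_eq_abs, abs_mul]
  exact mul_le_mul_of_nonneg_right (hk j) (abs_nonneg _)

theorem tendsto_matVec (h : R.Bounded a M) (hobj : ContDiff ℝ 2 P.obj)
    (hcon : ∀ j, ContDiff ℝ 2 (P.con j)) :
    Tendsto (fun k => matVec (R.B k) (R.d0 k)) atTop (𝓝 0) := by
  refine squeeze_zero_norm (fun k => h.norm_matVec k _) ?_
  simpa using (h.tendsto_norm_d0 hobj hcon).const_mul M

theorem tendsto_stationarity (h : R.Bounded a M) (hobj : ContDiff ℝ 2 P.obj)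
    (hcon : ∀ j, ContDiff ℝ 2 (P.con j)) :
    Tendsto (fun k => P.g0 (R.x k) + ∑ j, R.lam k j • P.g j (R.x k)) atTop (𝓝 0) := by
  have := (h.tendsto_matVec hobj hcon).neg
  rw [neg_zero] at this
  refine this.congr fun k => ?_
  rw [neg_eq_iff_add_eq_zero, ← (R.step1_multiplier k).stationary]
  abel

/-- Global convergence: every cluster point of the iterates is a KKT point. -/
theorem exists_isKKTPair (h : R.Bounded a M) (hindep : P.GradientsIndependent)
    (hobj : ContDiff ℝ 2 P.obj) (hcon : ∀ j, ContDiff ℝ 2 (P.con j))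
    {z : EuclideanSpace ℝ (Fin n)} (hz : MapClusterPt z atTop R.x) :
    ∃ lam, P.IsKKTPair z lam := by
  obtain ⟨U, hU, hUx⟩ := mapClusterPt_iff_ultrafilter.1 hz
  obtain ⟨Λ, hΛ0, hΛ⟩ := h.eventually_norm_lam_le hindep hobj hcon
  have hmem : ∀ᶠ k in (U : Filter ℕ), R.lam k ∈ Metric.closedBall (0 : Fin m → ℝ) Λ := by
    filter_upwards [hU hΛ] with k hk
    rw [mem_closedBall_zero_iff, pi_norm_le_iff_of_nonneg hΛ0]
    exact hk
  obtain ⟨lam, -, hlam⟩ := (isCompact_closedBall (0 : Fin m → ℝ) Λ).ultrafilter_le_nhds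
    (U.map R.lam) (le_principal_iff.2 hmem)
  have hlam : Tendsto R.lam (U : Filter ℕ) (𝓝 lam) := hlam
  have hlamj : ∀ j, Tendsto (fun k => R.lam k j) (U : Filter ℕ) (𝓝 (lam j)) :=
    fun j => (tendsto_pi_nhds.1 hlam) j
  have hφ := (h.tendsto_phi hobj hcon).mono_left hU
  refine ⟨lam, ⟨?_, fun j => ?_, fun j => ?_, fun j => ?_⟩⟩
  · refine tendsto_nhds_unique ?_ ((h.tendsto_stationarity hobj hcon).mono_left hU)
    exact (((continuous_g0 hobj).tendsto z).comp hUx).add (tendsto_finsetSum _ fun j _ =>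
      (hlamj j).smul (((continuous_g hcon j).tendsto z).comp hUx))
  · exact le_of_tendsto_of_tendsto' (((hcon j).continuous.tendsto z).comp hUx) hφ
      fun k => con_le_phi j _
  · exact ge_of_tendsto' (hlamj j) fun k => (R.step1_multiplier k).nonneg j
  · exact tendsto_nhds_unique
      ((hlamj j).mul (tendsto_fbar (fun j => (hcon j).continuous) hUx hφ j))
      ((h.tendsto_lam_mul_fbar hindep hobj hcon j).mono_left hU)

theorem tendsto_x (h : R.Bounded a M) (hindep : P.GradientsIndependent)
    (hobj : ContDiff ℝ 2 P.obj) (hcon : ∀ j, ContDiff ℝ 2 (P.con j))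
    {z : EuclideanSpace ℝ (Fin n)} {lam : Fin m → ℝ} (hz : MapClusterPt z atTop R.x)
    (hkkt : P.IsKKTPair z lam) (hss : P.StrongSecondOrder z lam) :
    Tendsto R.x atTop (𝓝 z) := by
  obtain ⟨r, hr, hiso⟩ := hkkt.isolated hss hindep hobj hcon
  refine tendsto_of_isolated_mapClusterPt (h.tendsto_increment hobj hcon) hz hr fun y hy hyz => ?_
  obtain ⟨mu, hmu⟩ := h.exists_isKKTPair hindep hobj hcon hy
  exact hiso y mu hmu hyz

theorem tendsto_lam (h : R.Bounded a M) (hindep : P.GradientsIndependent)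
    (hobj : ContDiff ℝ 2 P.obj) (hcon : ∀ j, ContDiff ℝ 2 (P.con j))
    {z : EuclideanSpace ℝ (Fin n)} {lam : Fin m → ℝ} (hkkt : P.IsKKTPair z lam)
    (hx : Tendsto R.x atTop (𝓝 z)) (j : Fin m) :
    Tendsto (fun k => R.lam k j) atTop (𝓝 (lam j)) :=
  hkkt.tendsto_multiplier hindep hobj hcon hx (h.tendsto_phi hobj hcon)
    (h.tendsto_stationarity hobj hcon) (h.tendsto_lam_mul_fbar hindep hobj hcon) j

end Run.Bounded
end NLProblem

/-! ### The test of Step 2 and the constraint conditions at the unit step. -/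

namespace NLProblem

variable {n m : ℕ} {P : NLProblem n m} {A : AlgParams} {R : P.Run A} {a M : ℝ}

namespace Run.Bounded

/-- The acceptance test of Step 2 is eventually satisfied. -/
theorem eventually_step2Test (h : R.Bounded a M) (hobj : ContDiff ℝ 2 P.obj)
    (hcon : ∀ j, ContDiff ℝ 2 (P.con j)) :
    ∀ᶠ k in atTop, P.Step2Test A (R.x k) (R.d0 k) (R.d0 k + R.d1 k) := by
  have hM := h.pos
  have ha := h.a_pos
  have hδ := A.two_lt_delta
  have hζ := A.zeta_pos
  have hξ := A.xi_pos
  have hσ : 0 < A.sigma := A.theta_pos.trans A.theta_lt_sigma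
  obtain ⟨C, hC0, hC⟩ := h.exists_correction_bound hobj hcon
  set K := 1 + C * (M + 1) with hK
  have hK0 : 0 < K := by positivity
  -- `N` dominates both `‖d0‖` and `‖d0 + d1‖`. In `N^δ` the factor `N^(δ-2)` vanishes, and `N²` is
  -- of order `‖d0‖² + φ^(2σ)`, where `φ^(2σ) ≤ φ^ϱ`.
  set N : ℕ → ℝ := fun k => K * (‖R.d0 k‖ + P.phi (R.x k) ^ A.sigma) with hN
  have hNlim : Tendsto N atTop (𝓝 0) := by
    simpa using ((h.tendsto_norm_d0 hobj hcon).add (h.tendsto_rpow_phi hobj hcon hσ)).const_mul K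
  have hNp : Tendsto (fun k => A.zeta * N k ^ (A.delta - 2) * (2 * K ^ 2)) atTop (𝓝 0) := by
    have h1 := hNlim.rpow_const (p := A.delta - 2) (Or.inr (by linarith))
    rw [Real.zero_rpow (by linarith)] at h1
    simpa using (h1.const_mul A.zeta).mul_const (2 * K ^ 2)
  filter_upwards [hNp.eventually (gt_mem_nhds (lt_min ha hξ)),
    (h.tendsto_phi hobj hcon).eventually (gt_mem_nhds one_pos)] with k hk hφ1
  have hφ0 := phi_nonneg (P := P) (R.x k)
  have hσ0 := rpow_phi_nonneg (P := P) (R.x k) A.sigma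
  have hϱ0 := rpow_phi_nonneg (P := P) (R.x k) A.varrho
  have hd0 := norm_nonneg (R.d0 k)
  have hN0 : 0 ≤ N k := by positivity
  have hd0N : ‖R.d0 k‖ ≤ N k := by
    simp only [hN, hK]
    have : 0 ≤ C * (M + 1) * (‖R.d0 k‖ + P.phi (R.x k) ^ A.sigma) := by positivity
    linarith
  have hdN : ‖R.d0 k + R.d1 k‖ ≤ N k := by
    refine (norm_add_le _ _).trans ?_
    have h1 := (hC k).1
    have h2 : ‖R.d0 k‖ ^ 2 ≤ M * ‖R.d0 k‖ := by
      rw [sq]; exact mul_le_mul_of_nonneg_right (h.norm_d0 k) hd0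
    have h3 : C * (‖R.d0 k‖ ^ 2 + P.phi (R.x k) ^ A.sigma) ≤
        C * ((M + 1) * (‖R.d0 k‖ + P.phi (R.x k) ^ A.sigma)) := by
      gcongr
      nlinarith [mul_nonneg hM.le hσ0]
    simp only [hN, hK]
    linarith
  have hpow : N k ^ A.delta ≤
      N k ^ (A.delta - 2) * (2 * K ^ 2 * (‖R.d0 k‖ ^ 2 + P.phi (R.x k) ^ A.varrho)) := by
    have h1 : N k ^ A.delta = N k ^ (A.delta - 2) * N k ^ 2 := by
      rw [← Real.rpow_natCast, ← Real.rpow_add_of_nonneg hN0 (by linarith) (by simp)]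
      congr 1; push_cast; ring
    rw [h1]
    refine mul_le_mul_of_nonneg_left ?_ (Real.rpow_nonneg hN0 _)
    have h2 : (P.phi (R.x k) ^ A.sigma) ^ 2 ≤ P.phi (R.x k) ^ A.varrho := by
      rw [← Real.rpow_natCast, ← Real.rpow_mul hφ0]
      refine Real.rpow_le_rpow_of_exponent_ge' hφ0 hφ1.le A.varrho_pos.le ?_
      push_cast
      linarith [A.varrho_lt_sigma]
    have h3 : N k ^ 2 ≤ K ^ 2 * (2 * (‖R.d0 k‖ ^ 2 + (P.phi (R.x k) ^ A.sigma) ^ 2)) := by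
      simp only [hN, mul_pow]
      gcongr
      nlinarith [sq_nonneg (‖R.d0 k‖ - P.phi (R.x k) ^ A.sigma)]
    calc N k ^ 2 ≤ K ^ 2 * (2 * (‖R.d0 k‖ ^ 2 + (P.phi (R.x k) ^ A.sigma) ^ 2)) := h3
      _ ≤ K ^ 2 * (2 * (‖R.d0 k‖ ^ 2 + P.phi (R.x k) ^ A.varrho)) := by gcongr
      _ = _ := by ring
  have hmain : A.zeta * N k ^ A.delta ≤ a * ‖R.d0 k‖ ^ 2 + A.xi * P.phi (R.x k) ^ A.varrho := by
    have h1 := mul_le_mul_of_nonneg_left hpow hζ.le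
    have h2 := mul_le_mul_of_nonneg_right (hk.le.trans (min_le_left _ _)) (sq_nonneg ‖R.d0 k‖)
    have h3 := mul_le_mul_of_nonneg_right (hk.le.trans (min_le_right _ _)) hϱ0
    linarith
  have hmin : -(N k ^ A.delta) ≤
      min (-(‖R.d0 k‖ ^ A.delta)) (-(‖R.d0 k + R.d1 k‖ ^ A.delta)) :=
    le_min (neg_le_neg (Real.rpow_le_rpow hd0 hd0N (by linarith)))
      (neg_le_neg (Real.rpow_le_rpow (norm_nonneg _) hdN (by linarith)))
  unfold Step2Test
  linarith [mul_le_mul_of_nonneg_left hmin hζ.le, h.inner_g0_le k]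

/-- The left side has the order of `‖d0‖ ‖d1‖ + ‖d1‖²`. Since `τ < 3`, `‖d0‖³` is `o(‖d0‖^τ)`; every
other term contains a vanishing factor as well. -/
theorem eventually_correction_errors_le (h : R.Bounded a M) (hobj : ContDiff ℝ 2 P.obj)
    (hcon : ∀ j, ContDiff ℝ 2 (P.con j)) {ε : ℝ} (hε : 0 < ε) :
    ∀ᶠ k in atTop, ‖R.d0 k‖ * (‖R.d0 k‖ ^ 2 + P.phi (R.x k) ^ A.sigma) +
      (‖R.d0 k‖ ^ 2 + P.phi (R.x k) ^ A.sigma) ^ 2 ≤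
        ε * (‖R.d0 k‖ ^ A.tau + P.phi (R.x k) ^ A.sigma) := by
  have hM := h.pos
  have hτ3 := A.tau_mem.2
  have hτ2 := A.tau_mem.1
  have hd := h.tendsto_norm_d0 hobj hcon
  have hlim : Tendsto (fun k => (1 + M) * (‖R.d0 k‖ ^ (3 - A.tau) + ‖R.d0 k‖) +
      (‖R.d0 k‖ ^ 2 + P.phi (R.x k) ^ A.sigma)) atTop (𝓝 0) := by
    have h1 := hd.rpow_const (p := 3 - A.tau) (Or.inr (by linarith))
    rw [Real.zero_rpow (by linarith)] at h1
    simpa using ((h1.add hd).const_mul (1 + M)).add (h.tendsto_correction_size hobj hcon)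
  filter_upwards [hlim.eventually (gt_mem_nhds hε)] with k hk
  have hd0 := norm_nonneg (R.d0 k)
  have hW := rpow_phi_nonneg (P := P) (R.x k) A.sigma
  have hT : 0 ≤ ‖R.d0 k‖ ^ A.tau := Real.rpow_nonneg hd0 _
  have hp : 0 ≤ ‖R.d0 k‖ ^ (3 - A.tau) := Real.rpow_nonneg hd0 _
  have hcube : ‖R.d0 k‖ ^ 3 = ‖R.d0 k‖ ^ (3 - A.tau) * ‖R.d0 k‖ ^ A.tau := by
    rw [← Real.rpow_natCast, ← Real.rpow_add_of_nonneg hd0 (by linarith) (by linarith)]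
    congr 1; push_cast; ring
  have hdM := h.norm_d0 k
  set D := ‖R.d0 k‖
  set W := P.phi (R.x k) ^ A.sigma
  set T := D ^ A.tau
  set p := D ^ (3 - A.tau)
  have h1 : D * (D ^ 2 + W) ≤ (p + D) * (T + W) := by
    have : D * (D ^ 2 + W) = p * T + D * W := by rw [← hcube]; ring
    nlinarith [mul_nonneg hp hW, mul_nonneg hd0 hT]
  have h2 : (D ^ 2 + W) ^ 2 ≤ M * (D * (D ^ 2 + W)) + (D ^ 2 + W) * (T + W) := by
    have h3 : D ^ 2 * (D ^ 2 + W) ≤ M * (D * (D ^ 2 + W)) := by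
      have := mul_le_mul_of_nonneg_right hdM (show 0 ≤ D * (D ^ 2 + W) by positivity)
      linarith
    have h4 : W * (D ^ 2 + W) ≤ (T + W) * (D ^ 2 + W) :=
      mul_le_mul_of_nonneg_right (by linarith) (by positivity)
    linarith
  have h3 := mul_le_mul_of_nonneg_left h1 (show 0 ≤ 1 + M by linarith)
  have h4 := mul_le_mul_of_nonneg_right hk.le (show 0 ≤ T + W by linarith)
  linarith

/-- With the corrected direction and the unit steplength, the constraint conditions of Step 3
eventually hold. -/
theorem eventually_constraint_decrease (h : R.Bounded a M) (hobj : ContDiff ℝ 2 P.obj)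
    (hcon : ∀ j, ContDiff ℝ 2 (P.con j)) :
    ∀ᶠ k in atTop, ∀ j, P.con j (R.x k + (R.d0 k + R.d1 k)) ≤
      P.con j (R.x k) - P.fbar j (R.x k)
        - A.alpha * (‖R.d0 k‖ ^ A.tau + P.phi (R.x k) ^ A.sigma) := by
  have hM := h.pos
  have hM1 := h.one_le
  obtain ⟨C₁, hC₁0, hC₁⟩ := h.exists_correction_bound hobj hcon
  obtain ⟨C, hC0, hC⟩ := exists_uniform_taylor_bound hobj hcon (M + M + 1)
  set K := M ^ 2 * C₁ + C * C₁ + C * C₁ ^ 2 with hK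
  have hK0 : 0 < K := by positivity
  have hz := (h.tendsto_correction_size hobj hcon).const_mul (2 * M * C₁)
  rw [mul_zero] at hz
  filter_upwards [h.eventually_correction_errors_le hobj hcon
      (show 0 < 1 / (2 * K) by positivity),
    hz.eventually (gt_mem_nhds one_pos),
    (h.tendsto_norm_d1 hobj hcon).eventually (gt_mem_nhds one_pos)] with k herr hzk hd1 j
  have hd1C := (hC₁ k).1
  have hh := (hC₁ k).2 j
  have hd0 := norm_nonneg (R.d0 k)
  have hW := rpow_phi_nonneg (P := P) (R.x k) A.sigma
  have hT : 0 ≤ ‖R.d0 k‖ ^ A.tau := Real.rpow_nonneg hd0 _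
  have hx := h.norm_x k
  have hdM := h.norm_d0 k
  have hxd : ‖R.x k + R.d0 k‖ ≤ M + M := (norm_add_le _ _).trans (add_le_add hx hdM)
  have htay0 := ((hC (R.x k) (R.d0 k) (by linarith) (by linarith)).2 j).1
  have htay1 := ((hC (R.x k + R.d0 k) (R.d1 k) (by linarith)
    ((norm_add_le _ _).trans (by linarith))).2 j).2
  have hlin := (R.step2_correction k).linearized j
  have hs := (R.step1_solution k).1 j
  have hfb := fbar_nonpos (P := P) j (R.x k)
  have hfbM := h.abs_fbar_le k j
  have hgd : |inner ℝ (P.g j (R.x k)) (R.d0 k)| ≤ M * ‖R.d0 k‖ :=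
    (abs_real_inner_le_norm _ _).trans (mul_le_mul_of_nonneg_right (h.norm_g k j) hd0)
  have hdot : inner ℝ (P.g j (R.x k + R.d0 k)) (R.d1 k) ≤
      inner ℝ (P.g j (R.x k)) (R.d1 k) + C * ‖R.d0 k‖ * ‖R.d1 k‖ := by
    have h1 := (le_abs_self _).trans
      (abs_real_inner_le_norm (P.g j (R.x k + R.d0 k) - P.g j (R.x k)) (R.d1 k))
    rw [inner_sub_left] at h1
    have h2 := mul_le_mul_of_nonneg_right htay0 (norm_nonneg (R.d1 k))
    linarith
  set z := ‖R.d0 k‖ ^ 2 + P.phi (R.x k) ^ A.sigma with hzdef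
  have hz0 : 0 ≤ z := by positivity
  set s := -(P.fbar j (R.x k) + inner ℝ (P.g j (R.x k)) (R.d0 k)) with hsdef
  have hs0 : 0 ≤ s := by linarith
  -- Here `s` is the slack of the linearized constraint. The part of `D_j h_j` proportional to `s`
  -- has a vanishing coefficient and is paid for by `s` itself, so no strict complementarity is
  -- needed.
  have hDh : P.diagD (R.x k) (R.d0 k) j * R.h1 k j ≤ s + M ^ 2 * C₁ * (‖R.d0 k‖ * z) := by
    have h1 : P.diagD (R.x k) (R.d0 k) j ≤ 2 * M * s + M ^ 2 * ‖R.d0 k‖ := by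
      have e1 : |P.fbar j (R.x k) + inner ℝ (P.g j (R.x k)) (R.d0 k)| = s := abs_of_nonpos hs
      have e2 : |P.fbar j (R.x k)| = -P.fbar j (R.x k) := abs_of_nonpos hfb
      rw [diagD, e1, mul_add]
      have e3 : |P.fbar j (R.x k)| * s ≤ M * s := mul_le_mul_of_nonneg_right hfbM hs0
      have e4 : |P.fbar j (R.x k)| ≤ s + M * ‖R.d0 k‖ := by
        rw [e2]
        linarith [(abs_le.1 hgd).2]
      have e5 := mul_le_mul_of_nonneg_right e4 hd0
      have e6 : s * ‖R.d0 k‖ ≤ s * M := mul_le_mul_of_nonneg_left hdM hs0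
      have e7 : M * ‖R.d0 k‖ * ‖R.d0 k‖ ≤ M * ‖R.d0 k‖ * M :=
        mul_le_mul_of_nonneg_left hdM (by positivity)
      nlinarith
    calc P.diagD (R.x k) (R.d0 k) j * R.h1 k j
        ≤ P.diagD (R.x k) (R.d0 k) j * |R.h1 k j| :=
          mul_le_mul_of_nonneg_left (le_abs_self _) (diagD_nonneg _ _ _)
      _ ≤ (2 * M * s + M ^ 2 * ‖R.d0 k‖) * (C₁ * z) :=
          mul_le_mul h1 hh (abs_nonneg _) (by positivity)
      _ = (2 * M * C₁ * z) * s + M ^ 2 * C₁ * (‖R.d0 k‖ * z) := by ring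
      _ ≤ 1 * s + M ^ 2 * C₁ * (‖R.d0 k‖ * z) := by gcongr
      _ = _ := by ring
  have herr1 : C * ‖R.d0 k‖ * ‖R.d1 k‖ ≤ C * C₁ * (‖R.d0 k‖ * z) := by
    calc C * ‖R.d0 k‖ * ‖R.d1 k‖ ≤ C * ‖R.d0 k‖ * (C₁ * z) := by gcongr
      _ = _ := by ring
  have herr2 : C * ‖R.d1 k‖ ^ 2 ≤ C * C₁ ^ 2 * z ^ 2 := by
    calc C * ‖R.d1 k‖ ^ 2 ≤ C * (C₁ * z) ^ 2 := by gcongr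
      _ = _ := by ring
  -- The errors use up half of the margin `‖d0‖^τ + φ^σ`; the other half suffices because `α < ½`.
  have htotal : M ^ 2 * C₁ * (‖R.d0 k‖ * z) + C * C₁ * (‖R.d0 k‖ * z) + C * C₁ ^ 2 * z ^ 2 ≤
      1 / 2 * (‖R.d0 k‖ ^ A.tau + P.phi (R.x k) ^ A.sigma) := by
    have h1 : 0 ≤ ‖R.d0 k‖ * z := by positivity
    have h2 := mul_le_mul_of_nonneg_left herr hK0.le
    have h3 : K * (1 / (2 * K) * (‖R.d0 k‖ ^ A.tau + P.phi (R.x k) ^ A.sigma)) =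
        1 / 2 * (‖R.d0 k‖ ^ A.tau + P.phi (R.x k) ^ A.sigma) := by field_simp
    rw [h3] at h2
    have h4 : 0 ≤ (M ^ 2 * C₁ + C * C₁) * z ^ 2 := by positivity
    have h5 : 0 ≤ C * C₁ ^ 2 * (‖R.d0 k‖ * z) := by positivity
    have h6 : K * (‖R.d0 k‖ * z + z ^ 2) = M ^ 2 * C₁ * (‖R.d0 k‖ * z) +
      C * C₁ * (‖R.d0 k‖ * z) + C * C₁ ^ 2 * z ^ 2 + (M ^ 2 * C₁ + C * C₁) * z ^ 2 +
      C * C₁ ^ 2 * (‖R.d0 k‖ * z) := by rw [hK]; ring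
    linarith
  have hα := mul_le_mul_of_nonneg_right A.alpha_mem.2.le
    (show 0 ≤ ‖R.d0 k‖ ^ A.tau + P.phi (R.x k) ^ A.sigma by linarith)
  rw [rhsCorrection] at hlin
  have htop := (abs_le.1 htay1).2
  -- Expanding at `x + d0` and inserting the equation for `g_jᵀd1` cancels `f_j(x + d0)`. What
  -- remains is `f_j - fbar_j - s`, minus the margin, plus `D_j h_j` and the errors.
  rw [← add_assoc]
  linarith

end Run.Bounded
end NLProblem

/-! ### Second-order expansion of the objective and acceptance of the unit step. -/

namespace NLProblem

variable {n m : ℕ} {P : NLProblem n m} {A : AlgParams} {R : P.Run A} {a M : ℝ}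

namespace Run.Bounded

open Asymptotics

/-- The scale `‖d0‖² + φ^θ` is that of the slack in the objective condition of Step 3; all
remainders are compared with it. -/
theorem isBigO_sq_norm_d0 (R : P.Run A) :
    (fun k => ‖R.d0 k‖ ^ 2) =O[atTop] fun k => ‖R.d0 k‖ ^ 2 + P.phi (R.x k) ^ A.theta :=
  IsBigO.of_bound 1 (Eventually.of_forall fun k => by
    have h1 := sq_nonneg ‖R.d0 k‖
    have h2 := rpow_phi_nonneg (P := P) (R.x k) A.theta
    rw [Real.norm_of_nonneg h1, Real.norm_of_nonneg (add_nonneg h1 h2)]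
    linarith)

theorem isLittleO_rpow_sigma (h : R.Bounded a M) (hobj : ContDiff ℝ 2 P.obj)
    (hcon : ∀ j, ContDiff ℝ 2 (P.con j)) :
    (fun k => P.phi (R.x k) ^ A.sigma) =o[atTop]
      fun k => ‖R.d0 k‖ ^ 2 + P.phi (R.x k) ^ A.theta := by
  have hst := A.theta_lt_sigma
  have hlim := (isLittleO_one_iff ℝ).2 (h.tendsto_rpow_phi hobj hcon (sub_pos.2 hst))
  have h1 : (fun k => P.phi (R.x k) ^ A.theta) =O[atTop]
      fun k => ‖R.d0 k‖ ^ 2 + P.phi (R.x k) ^ A.theta :=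
    IsBigO.of_bound 1 (Eventually.of_forall fun k => by
      have h1 := sq_nonneg ‖R.d0 k‖
      have h2 := rpow_phi_nonneg (P := P) (R.x k) A.theta
      rw [Real.norm_of_nonneg h2, Real.norm_of_nonneg (add_nonneg h1 h2)]
      linarith)
  refine (hlim.mul_isBigO h1).congr (fun k => ?_) fun k => one_mul _
  rw [← Real.rpow_add_of_nonneg (phi_nonneg _) (by linarith) A.theta_pos.le]
  congr 1; ring

theorem isLittleO_rpow_tau (h : R.Bounded a M) (hobj : ContDiff ℝ 2 P.obj)
    (hcon : ∀ j, ContDiff ℝ 2 (P.con j)) :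
    (fun k => ‖R.d0 k‖ ^ A.tau) =o[atTop]
      fun k => ‖R.d0 k‖ ^ 2 + P.phi (R.x k) ^ A.theta := by
  have hτ := A.tau_mem.1
  have hlim := (h.tendsto_norm_d0 hobj hcon).rpow_const (p := A.tau - 2) (Or.inr (by linarith))
  rw [Real.zero_rpow (by linarith)] at hlim
  refine (((isLittleO_one_iff ℝ).2 hlim).mul_isBigO (isBigO_sq_norm_d0 R)).congr
    (fun k => ?_) fun k => one_mul _
  rw [← Real.rpow_natCast, ← Real.rpow_add_of_nonneg (norm_nonneg _) (by linarith) (by simp)]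
  congr 1; push_cast; ring

theorem isBigO_correction_size (h : R.Bounded a M) (hobj : ContDiff ℝ 2 P.obj)
    (hcon : ∀ j, ContDiff ℝ 2 (P.con j)) :
    (fun k => ‖R.d0 k‖ ^ 2 + P.phi (R.x k) ^ A.sigma) =O[atTop]
      fun k => ‖R.d0 k‖ ^ 2 + P.phi (R.x k) ^ A.theta :=
  (isBigO_sq_norm_d0 R).add (h.isLittleO_rpow_sigma hobj hcon).isBigO

theorem isBigO_norm_d1 (h : R.Bounded a M) (hobj : ContDiff ℝ 2 P.obj)
    (hcon : ∀ j, ContDiff ℝ 2 (P.con j)) :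
    (fun k => ‖R.d1 k‖) =O[atTop] fun k => ‖R.d0 k‖ ^ 2 + P.phi (R.x k) ^ A.theta := by
  obtain ⟨C, -, hC⟩ := h.exists_correction_bound hobj hcon
  refine (IsBigO.of_bound C (Eventually.of_forall fun k => ?_)).trans
    (h.isBigO_correction_size hobj hcon)
  rw [norm_norm, Real.norm_of_nonneg (add_nonneg (sq_nonneg _) (rpow_phi_nonneg _ _))]
  exact (hC k).1

theorem isLittleO_norm_d0_mul_norm_d1 (h : R.Bounded a M) (hobj : ContDiff ℝ 2 P.obj)
    (hcon : ∀ j, ContDiff ℝ 2 (P.con j)) :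
    (fun k => ‖R.d0 k‖ * ‖R.d1 k‖) =o[atTop]
      fun k => ‖R.d0 k‖ ^ 2 + P.phi (R.x k) ^ A.theta :=
  (((isLittleO_one_iff ℝ).2 (h.tendsto_norm_d0 hobj hcon)).mul_isBigO
    (h.isBigO_norm_d1 hobj hcon)).congr (fun _ => rfl) fun _ => one_mul _

theorem isLittleO_sq_norm_d1 (h : R.Bounded a M) (hobj : ContDiff ℝ 2 P.obj)
    (hcon : ∀ j, ContDiff ℝ 2 (P.con j)) :
    (fun k => ‖R.d1 k‖ ^ 2) =o[atTop]
      fun k => ‖R.d0 k‖ ^ 2 + P.phi (R.x k) ^ A.theta :=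
  (((isLittleO_one_iff ℝ).2 (h.tendsto_norm_d1 hobj hcon)).mul_isBigO
    (h.isBigO_norm_d1 hobj hcon)).congr (fun _ => (sq _).symm) fun _ => one_mul _

theorem isBigO_sq_norm_direction (h : R.Bounded a M) (hobj : ContDiff ℝ 2 P.obj)
    (hcon : ∀ j, ContDiff ℝ 2 (P.con j)) :
    (fun k => ‖R.d0 k + R.d1 k‖ ^ 2) =O[atTop]
      fun k => ‖R.d0 k‖ ^ 2 + P.phi (R.x k) ^ A.theta := by
  refine (IsBigO.of_bound 2 (Eventually.of_forall fun k => ?_)).trans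
    ((isBigO_sq_norm_d0 R).add (h.isLittleO_sq_norm_d1 hobj hcon).isBigO)
  rw [Real.norm_of_nonneg (sq_nonneg _), Real.norm_of_nonneg (by positivity)]
  have h1 := pow_le_pow_left₀ (norm_nonneg _) (norm_add_le (R.d0 k) (R.d1 k)) 2
  nlinarith [sq_nonneg (‖R.d0 k‖ - ‖R.d1 k‖)]

theorem isLittleO_taylor {f : EuclideanSpace ℝ (Fin n) → ℝ} (hf : ContDiff ℝ 2 f)
    {z : EuclideanSpace ℝ (Fin n)} {x d : ℕ → EuclideanSpace ℝ (Fin n)}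
    (hx : Tendsto x atTop (𝓝 z)) (hd : Tendsto (fun k => ‖d k‖) atTop (𝓝 0)) :
    (fun k => f (x k + d k) - f (x k) - inner ℝ (gradient f (x k)) (d k)
      - 1 / 2 * inner ℝ (d k) (fderiv ℝ (gradient f) z (d k))) =o[atTop]
      fun k => ‖d k‖ ^ 2 := by
  refine IsLittleO.of_bound fun ε hε => ?_
  obtain ⟨r, hr, hT⟩ := taylor_littleO hf z hε
  filter_upwards [(tendsto_iff_norm_sub_tendsto_zero.1 hx).eventually (gt_mem_nhds hr),
    hd.eventually (gt_mem_nhds hr)] with k hk1 hk2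
  rw [Real.norm_eq_abs, Real.norm_of_nonneg (sq_nonneg _)]
  exact hT _ _ hk1 hk2

/-- Second order expansion of the objective along the corrected direction. -/
theorem isLittleO_objective (h : R.Bounded a M) (hindep : P.GradientsIndependent)
    (hobj : ContDiff ℝ 2 P.obj) (hcon : ∀ j, ContDiff ℝ 2 (P.con j))
    {z : EuclideanSpace ℝ (Fin n)} {lam : Fin m → ℝ} (hkkt : P.IsKKTPair z lam)
    (hx : Tendsto R.x atTop (𝓝 z))
    (hdm : (fun k => P.hessL z lam (R.d0 k) - matVec (R.B k) (R.d0 k)) =o[atTop] R.d0) :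
    (fun k => P.obj (R.x k + (R.d0 k + R.d1 k)) - P.obj (R.x k)
      - inner ℝ (P.g0 (R.x k)) (R.d0 k)
      - 1 / 2 * inner ℝ (R.d0 k) (matVec (R.B k) (R.d0 k))) =o[atTop]
      fun k => ‖R.d0 k‖ ^ 2 + P.phi (R.x k) ^ A.theta := by
  set e : ℕ → ℝ := fun k => ‖R.d0 k‖ ^ 2 + P.phi (R.x k) ^ A.theta with he
  have hd0 := h.tendsto_norm_d0 hobj hcon
  have hd1 := h.tendsto_norm_d1 hobj hcon
  have hsq : (fun k => ‖R.d0 k‖ ^ 2) =O[atTop] e := isBigO_sq_norm_d0 R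
  have hcross := h.isLittleO_norm_d0_mul_norm_d1 hobj hcon
  have hlam := h.tendsto_lam hindep hobj hcon hkkt hx
  have hlamO : ∀ j, (fun k => R.lam k j) =O[atTop] fun _ => (1 : ℝ) := fun j =>
    (hlam j).isBigO_one ℝ
  set H0 := fderiv ℝ P.g0 z with hH0
  set H : Fin m → _ := fun j => fderiv ℝ (P.g j) z with hH
  have hd : Tendsto (fun k => ‖R.d0 k + R.d1 k‖) atTop (𝓝 0) :=
    squeeze_zero (fun _ => norm_nonneg _) (fun _ => norm_add_le _ _) (by simpa using hd0.add hd1)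
  have hobjTaylor : (fun k => P.obj (R.x k + (R.d0 k + R.d1 k)) - P.obj (R.x k)
      - inner ℝ (P.g0 (R.x k)) (R.d0 k + R.d1 k)
      - 1 / 2 * inner ℝ (R.d0 k + R.d1 k) (H0 (R.d0 k + R.d1 k))) =o[atTop] e :=
    (isLittleO_taylor hobj hx hd).trans_isBigO (h.isBigO_sq_norm_direction hobj hcon)
  have hquad : (fun k => 1 / 2 * (inner ℝ (R.d0 k + R.d1 k) (H0 (R.d0 k + R.d1 k))
      - inner ℝ (R.d0 k) (H0 (R.d0 k)))) =o[atTop] e := by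
    refine IsLittleO.const_mul_left ?_ _
    refine (IsBigO.of_bound ‖H0‖ (Eventually.of_forall fun k => ?_)).trans_isLittleO
      ((hcross.const_mul_left 2).add (h.isLittleO_sq_norm_d1 hobj hcon))
    have h1 : ∀ u v, |inner ℝ u (H0 v)| ≤ ‖H0‖ * (‖u‖ * ‖v‖) := fun u v =>
      (abs_real_inner_le_norm _ _).trans (by
        have := mul_le_mul_of_nonneg_left (H0.le_opNorm v) (norm_nonneg u)
        linarith)
    have h2 : inner ℝ (R.d0 k + R.d1 k) (H0 (R.d0 k + R.d1 k)) - inner ℝ (R.d0 k) (H0 (R.d0 k)) =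
        inner ℝ (R.d0 k) (H0 (R.d1 k)) + inner ℝ (R.d1 k) (H0 (R.d0 k)) +
          inner ℝ (R.d1 k) (H0 (R.d1 k)) := by
      simp only [map_add, inner_add_left, inner_add_right]
      ring
    rw [h2, Real.norm_eq_abs, Real.norm_of_nonneg (by positivity)]
    refine (abs_add_three _ _ _).trans ?_
    linarith [h1 (R.d0 k) (R.d1 k), h1 (R.d1 k) (R.d0 k), h1 (R.d1 k) (R.d1 k)]
  have hBd : (fun k => inner ℝ (matVec (R.B k) (R.d0 k)) (R.d1 k)) =o[atTop] e := by
    refine (IsBigO.of_bound M (Eventually.of_forall fun k => ?_)).trans_isLittleO hcross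
    rw [Real.norm_of_nonneg (by positivity : 0 ≤ ‖R.d0 k‖ * ‖R.d1 k‖)]
    refine (norm_inner_le_norm _ _).trans ?_
    have := mul_le_mul_of_nonneg_right (h.norm_matVec k (R.d0 k)) (norm_nonneg (R.d1 k))
    linarith
  have hE : ∀ j, (fun k => R.lam k j * (‖R.d0 k‖ ^ A.tau + P.phi (R.x k) ^ A.sigma))
      =o[atTop] e := fun j =>
    ((hlamO j).mul_isLittleO ((h.isLittleO_rpow_tau hobj hcon).add
      (h.isLittleO_rpow_sigma hobj hcon))).congr (fun _ => rfl) fun _ => one_mul _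
  have hconTaylor : ∀ j, (fun k => R.lam k j * (P.con j (R.x k + R.d0 k) - P.con j (R.x k)
      - inner ℝ (P.g j (R.x k)) (R.d0 k) - 1 / 2 * inner ℝ (R.d0 k) (H j (R.d0 k))))
      =o[atTop] e := fun j =>
    ((hlamO j).mul_isLittleO ((isLittleO_taylor (hcon j) hx hd0).trans_isBigO hsq)).congr
      (fun _ => rfl) fun _ => one_mul _
  have hlamdiff : ∀ j, (fun k => (R.lam k j - lam j) * (1 / 2 * inner ℝ (R.d0 k) (H j (R.d0 k))))
      =o[atTop] e := by
    intro j
    have h1 : Tendsto (fun k => R.lam k j - lam j) atTop (𝓝 0) := by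
      simpa using (hlam j).sub_const (lam j)
    have h2 : (fun k => 1 / 2 * inner ℝ (R.d0 k) (H j (R.d0 k))) =O[atTop] e := by
      refine IsBigO.const_mul_left ?_ _
      refine (IsBigO.of_bound ‖H j‖ (Eventually.of_forall fun k => ?_)).trans hsq
      rw [Real.norm_of_nonneg (sq_nonneg _)]
      refine (norm_inner_le_norm _ _).trans ?_
      have := mul_le_mul_of_nonneg_left ((H j).le_opNorm (R.d0 k)) (norm_nonneg (R.d0 k))
      linarith
    exact (((isLittleO_one_iff ℝ).2 h1).mul_isBigO h2).congr (fun _ => rfl) fun _ => one_mul _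
  -- Where `λ_j ≠ 0` the linearized constraint is active, so `fbar_j = -g_jᵀd0` and `D_j =
  -- O(‖d0‖²)`; moreover `h1 → 0`.
  have hDh : ∀ j, (fun k => R.lam k j * (P.diagD (R.x k) (R.d0 k) j * R.h1 k j)) =o[atTop] e := by
    intro j
    obtain ⟨C, -, hC⟩ := h.exists_correction_bound hobj hcon
    have hh : Tendsto (fun k => |R.h1 k j|) atTop (𝓝 0) :=
      squeeze_zero (fun _ => abs_nonneg _) (fun k => (hC k).2 j)
        (by simpa using (h.tendsto_correction_size hobj hcon).const_mul C)
    have h1 : (fun k => R.lam k j * P.diagD (R.x k) (R.d0 k) j) =O[atTop] e := by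
      have h2 : (fun k => R.lam k j * ‖R.d0 k‖ ^ 2) =O[atTop] e :=
        ((hlamO j).mul hsq).congr (fun _ => rfl) fun _ => one_mul _
      refine (IsBigO.of_bound M (Eventually.of_forall fun k => ?_)).trans h2
      have hc := (R.step1_multiplier k).complementary j
      have hl := (R.step1_multiplier k).nonneg j
      rw [Real.norm_of_nonneg (mul_nonneg hl (diagD_nonneg _ _ _)),
        Real.norm_of_nonneg (by positivity)]
      rcases mul_eq_zero.1 hc with h0 | h0
      · simp [h0]
      · have h3 : P.fbar j (R.x k) = -inner ℝ (P.g j (R.x k)) (R.d0 k) := by linarith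
        have h4 : |P.fbar j (R.x k)| ≤ M * ‖R.d0 k‖ := by
          rw [h3, abs_neg]
          exact (abs_real_inner_le_norm _ _).trans
            (mul_le_mul_of_nonneg_right (h.norm_g k j) (norm_nonneg _))
        rw [diagD, h0, abs_zero, zero_add]
        have := mul_le_mul_of_nonneg_left
          (mul_le_mul_of_nonneg_right h4 (norm_nonneg (R.d0 k))) hl
        linarith
    refine (h1.mul_isLittleO ((isLittleO_one_iff ℝ).2
      ((tendsto_zero_iff_abs_tendsto_zero _).2 hh))).congr (fun k => ?_) fun _ => mul_one _
    ring
  -- The only place where the Hessian approximation property of `B` enters.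
  have hmodel : (fun k => 1 / 2 * inner ℝ (R.d0 k)
      (P.hessL z lam (R.d0 k) - matVec (R.B k) (R.d0 k))) =o[atTop] e := by
    refine IsLittleO.const_mul_left ?_ _
    have h1 : (fun k => ‖R.d0 k‖ *
        ‖P.hessL z lam (R.d0 k) - matVec (R.B k) (R.d0 k)‖) =o[atTop] fun k => ‖R.d0 k‖ ^ 2 :=
      ((isBigO_refl (fun k => ‖R.d0 k‖) atTop).mul_isLittleO hdm.norm_norm).congr
        (fun _ => rfl) fun _ => (sq _).symm
    refine IsBigO.trans_isLittleO ?_ (h1.trans_isBigO hsq)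
    refine IsBigO.of_bound 1 (Eventually.of_forall fun k => ?_)
    rw [one_mul, Real.norm_of_nonneg (by positivity :
      0 ≤ ‖R.d0 k‖ * ‖P.hessL z lam (R.d0 k) - matVec (R.B k) (R.d0 k)‖)]
    exact norm_inner_le_norm _ _
  have hsum := IsLittleO.sum (s := Finset.univ) fun j (_ : j ∈ Finset.univ) =>
    (((hE j).add (hconTaylor j)).add (hlamdiff j)).sub (hDh j)
  refine ((((hobjTaylor.add hquad).sub hBd).add hsum).add hmodel).congr_left fun k => ?_
  -- Stationarity expresses `g₀ᵀd1` through `g_jᵀd1`, and the linear system makes the latter `-½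
  -- d0ᵀ∇²f_j d0` up to small terms. This supplies the constraint part of `∇²L`.
  have hg0d1 : inner ℝ (P.g0 (R.x k)) (R.d1 k) =
      -inner ℝ (matVec (R.B k) (R.d0 k)) (R.d1 k)
        - ∑ j, R.lam k j * inner ℝ (P.g j (R.x k)) (R.d1 k) := by
    have h1 : inner ℝ (P.g0 (R.x k) + matVec (R.B k) (R.d0 k) +
        ∑ j, R.lam k j • P.g j (R.x k)) (R.d1 k) = 0 := by
      rw [(R.step1_multiplier k).stationary, inner_zero_left]
    rw [inner_add_left, inner_add_left, sum_inner] at h1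
    simp only [real_inner_smul_left] at h1
    linarith
  have hHess : inner ℝ (R.d0 k) (P.hessL z lam (R.d0 k)) =
      inner ℝ (R.d0 k) (H0 (R.d0 k)) + ∑ j, lam j * inner ℝ (R.d0 k) (H j (R.d0 k)) := by
    rw [hessL_apply hobj hcon, inner_add_right, inner_sum]
    simp only [real_inner_smul_right, hH0, hH]
  have hterm : ∑ j, (R.lam k j * (‖R.d0 k‖ ^ A.tau + P.phi (R.x k) ^ A.sigma) +
      R.lam k j * (P.con j (R.x k + R.d0 k) - P.con j (R.x k)
        - inner ℝ (P.g j (R.x k)) (R.d0 k) - 1 / 2 * inner ℝ (R.d0 k) (H j (R.d0 k))) +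
      (R.lam k j - lam j) * (1 / 2 * inner ℝ (R.d0 k) (H j (R.d0 k))) -
      R.lam k j * (P.diagD (R.x k) (R.d0 k) j * R.h1 k j)) =
      -∑ j, R.lam k j * inner ℝ (P.g j (R.x k)) (R.d1 k) -
        1 / 2 * ∑ j, lam j * inner ℝ (R.d0 k) (H j (R.d0 k)) := by
    rw [Finset.mul_sum, ← Finset.sum_neg_distrib, ← Finset.sum_sub_distrib]
    refine Finset.sum_congr rfl fun j _ => ?_
    have h1 := (R.step2_correction k).linearized j
    rw [rhsCorrection] at h1
    linear_combination R.lam k j * h1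
  rw [Finset.sum_apply, hterm, inner_sub_right, hHess, inner_add_right (P.g0 (R.x k)), hg0d1]
  ring

/-- With the corrected direction and the unit steplength, the objective condition of Step 3
eventually holds. -/
theorem eventually_objective_decrease (h : R.Bounded a M) (hindep : P.GradientsIndependent)
    (hobj : ContDiff ℝ 2 P.obj) (hcon : ∀ j, ContDiff ℝ 2 (P.con j))
    {z : EuclideanSpace ℝ (Fin n)} {lam : Fin m → ℝ} (hkkt : P.IsKKTPair z lam)
    (hx : Tendsto R.x atTop (𝓝 z))
    (hdm : (fun k => P.hessL z lam (R.d0 k) - matVec (R.B k) (R.d0 k)) =o[atTop] R.d0) :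
    ∀ᶠ k in atTop, P.obj (R.x k + (R.d0 k + R.d1 k)) ≤ P.obj (R.x k) +
      A.alpha * inner ℝ (P.g0 (R.x k)) (R.d0 k) +
      A.rho * (1 - A.alpha) * P.phi (R.x k) ^ A.theta := by
  have hα := A.alpha_mem.2
  have hρ := A.one_lt_rho
  have ha := h.a_pos
  -- Since `(1 - α) g₀ᵀd0 + ½ d0ᵀB d0 ≤ -(½ - α) a ‖d0‖²`, this coefficient and the one of `φ^θ` are
  -- the slack available for the remainder.
  have hε1 : 0 < (1 / 2 - A.alpha) * a := mul_pos (by linarith) ha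
  have hε2 : 0 < A.rho * (1 - A.alpha) := mul_pos (by linarith) (by linarith)
  filter_upwards [(h.isLittleO_objective hindep hobj hcon hkkt hx hdm).bound
    (lt_min hε1 hε2)] with k hk
  have hd2 := sq_nonneg ‖R.d0 k‖
  have hφ := rpow_phi_nonneg (P := P) (R.x k) A.theta
  rw [Real.norm_eq_abs, Real.norm_of_nonneg (add_nonneg hd2 hφ), mul_add] at hk
  have h1 := (abs_le.1 hk).2
  have h2 := mul_le_mul_of_nonneg_right
    (min_le_left ((1 / 2 - A.alpha) * a) (A.rho * (1 - A.alpha))) hd2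
  have h3 := mul_le_mul_of_nonneg_right
    (min_le_right ((1 / 2 - A.alpha) * a) (A.rho * (1 - A.alpha))) hφ
  have h4 := mul_le_mul_of_nonneg_left (R.step1_multiplier k).inner_g0_le
    (show 0 ≤ 1 - A.alpha by linarith)
  have h5 := mul_le_mul_of_nonneg_left (h.coercive k (R.d0 k))
    (show 0 ≤ 1 / 2 - A.alpha by linarith)
  linarith

/-- The unit steplength is eventually acceptable in Step 3. -/
theorem eventually_step3Conditions (h : R.Bounded a M) (hindep : P.GradientsIndependent)
    (hobj : ContDiff ℝ 2 P.obj) (hcon : ∀ j, ContDiff ℝ 2 (P.con j))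
    {z : EuclideanSpace ℝ (Fin n)} {lam : Fin m → ℝ} (hkkt : P.IsKKTPair z lam)
    (hx : Tendsto R.x atTop (𝓝 z))
    (hdm : (fun k => P.hessL z lam (R.d0 k) - matVec (R.B k) (R.d0 k)) =o[atTop] R.d0) :
    ∀ᶠ k in atTop, P.Step3Conditions A (R.x k) (R.d0 k) (R.d0 k + R.d1 k) 1 := by
  filter_upwards [h.eventually_objective_decrease hindep hobj hcon hkkt hx hdm,
    h.eventually_constraint_decrease hobj hcon] with k hk hck
  refine ⟨?_, fun j hj => ?_, fun j hj => ?_⟩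
  · rw [one_smul, mul_one, mul_one]
    exact hk
  · have h1 := hck j
    have h2 : P.fbar j (R.x k) = P.con j (R.x k) - P.phi (R.x k) := by
      rw [fbar, if_neg hj.not_ge]
    rw [one_smul, mul_one]
    linarith
  · have h1 := hck j
    have h2 : P.fbar j (R.x k) = P.con j (R.x k) := by rw [fbar, if_pos hj]
    have h3 : 0 ≤ A.alpha * (‖R.d0 k‖ ^ A.tau + P.phi (R.x k) ^ A.sigma) :=
      mul_nonneg A.alpha_mem.1.le
        (add_nonneg (Real.rpow_nonneg (norm_nonneg _) _) (rpow_phi_nonneg _ _))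
    rw [one_smul]
    linarith

end Run.Bounded

theorem Step3Succeeds.eq_one {x d0 d : EuclideanSpace ℝ (Fin n)} {t : ℝ}
    (h : P.Step3Succeeds A x d0 d t) (h1 : P.Step3Conditions A x d0 d 1) : t = 1 := by
  obtain ⟨i, rfl, -, -, hmin⟩ := h
  rcases Nat.eq_zero_or_pos i with rfl | hi
  · exact pow_zero _
  · exact absurd (by rwa [pow_zero]) (hmin 0 hi)

theorem Step3Conditions.not_step3Fails {x d0 d : EuclideanSpace ℝ (Fin n)}
    (h1 : P.Step3Conditions A x d0 d 1) : ¬ P.Step3Fails A x d0 d := fun h =>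
  h 0 (by simpa using A.eps_mem.2.le) (by rwa [pow_zero])

end NLProblem

/-! ### Assembly. -/

theorem theorem3 {n m : ℕ} (P : NLProblem n m) (A : AlgParams) (R : P.Run A)
    (hindep : P.GradientsIndependent)
    (hB : ∃ a b : ℝ, 0 < a ∧ 0 < b ∧ ∀ (k : ℕ) (d : EuclideanSpace ℝ (Fin n)),
      a * ‖d‖ ^ 2 ≤ inner ℝ d (matVec (R.B k) d) ∧
      inner ℝ d (matVec (R.B k) d) ≤ b * ‖d‖ ^ 2)
    (hobj : ContDiff ℝ 2 P.obj) (hcon : ∀ j, ContDiff ℝ 2 (P.con j))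
    (hbdd : Bornology.IsBounded (Set.range R.x))
    (xstar : EuclideanSpace ℝ (Fin n)) (hacc : MapClusterPt xstar atTop R.x)
    (hssosc : ∀ lam : Fin m → ℝ, P.IsKKTPair xstar lam → P.StrongSecondOrder xstar lam)
    (hdm : ∀ lam : Fin m → ℝ, P.IsKKTPair xstar lam →
      (fun k => P.hessL xstar lam (R.d0 k) - matVec (R.B k) (R.d0 k)) =o[atTop] R.d0) :
    ∀ᶠ k in atTop,
      P.Step3Conditions A (R.x k) (R.d0 k) (R.d0 k + R.d1 k) 1 ∧
      R.trace k = [1, 2, 3, 6] ∧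
      R.t k = 1 ∧
      R.x (k + 1) = R.x k + (R.d0 k + R.d1 k) ∧
      qpCount (R.trace k) = 1 ∧
      sleCount (R.trace k) = 1 := by
  obtain ⟨a, b, ha, -, hab⟩ := hB
  obtain ⟨M, hM⟩ := R.exists_bounded hindep ha hab hobj hcon hbdd
  -- The multiplier at `xstar` is supplied by global convergence; the second-order and Hessian
  -- hypotheses are then used for it.
  obtain ⟨lam, hkkt⟩ := hM.exists_isKKTPair hindep hobj hcon hacc
  have hx := hM.tendsto_x hindep hobj hcon hacc hkkt (hssosc lam hkkt)
  filter_upwards [hM.eventually_step3Conditions hindep hobj hcon hkkt hx (hdm lam hkkt),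
    hM.eventually_step2Test hobj hcon] with k hcond htest
  rcases (R.iteration k).trace_or_steps45 with ⟨htr, hdir, hsucc⟩ | ⟨-, hfail⟩
  · have ht := hsucc.eq_one hcond
    refine ⟨hcond, htr, ht, ?_, ?_, ?_⟩
    · rw [R.step6_update k, ht, hdir, one_smul]
    · rw [htr]; rfl
    · rw [htr]; rfl
  · exact absurd hfail (not_or.2 ⟨not_not.2 htest, hcond.not_step3Fails⟩)
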